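/- Let $0\le s\le 5$ and let $\mathbb{E}^5_s$ be $\mathbb{R}^5$ with the scalar product $\langle v,w\rangle=-\sum_{i\le s}v_iw_i+\sum_{i>s}v_iw_i$. Let $x:M^4\to\mathbb{E}^5_s$ be a nondegenerate hypersurface, that is, a smooth map from a smooth $4$-manifold such that the induced symmetric bilinear form $g=x^*\langle\cdot,\cdot\rangle$ is nondegenerate at every point. For a unit normal vector $\xi$, $\langle\xi,\xi\rangle=\varepsilon=\pm1$, let $A$ be the shape operator, $\langle AX,Y\rangle=\langle \mathrm{II}(X,Y),\xi\rangle$, where $\mathrm{II}$ is the vector-valued second fundamental form; the complex eigenvalues of $A$ are called the principal curvatures, and the mean curvature vector field is $\vec H=\tfrac14\operatorname{tr}_g\mathrm{II}=\tfrac14\varepsilon(\operatorname{tr}A)\,\xi$. Assume that (i) the mean curvature vector field is proper: there is a constant $\lambda\in\mathbb{R}$ with $\Delta\vec H=\lambda\vec H$ on $M$, where $\Delta=-\operatorname{tr}_g\nabla^2$ is the Laplace operator of $(M,g)$ acting on each Cartesian component of $\vec H$ in $\mathbb{R}^5$; (ii) at every point of $M$ there are exactly two distinct principal curvatures, and both are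 imaginary (that is, not real). Then $M$ is minimal, i.e. $\vec H=0$ everywhere on $M$. -/

import Mathlib

open scoped Manifold ContDiff

namespace PseudoEuclidean

noncomputable section

/-- The scalar product of pseudo-Euclidean space `𝔼ᵐ_s` of index `s`:
`⟨v, w⟩ = - ∑_{i < s} vᵢ wᵢ + ∑_{i ≥ s} vᵢ wᵢ`. -/
def scalarProduct {m : ℕ} (s : ℕ) (v w : EuclideanSpace ℝ (Fin m)) : ℝ :=
  ∑ i : Fin m, (if (i : ℕ) < s then -1 else 1) * (v i * w i)

/-- The `i`-th partial derivative `∂ᵢ φ` of a vector valued function of `n` real variables. -/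
def pd {n : ℕ} {F : Type*} [NormedAddCommGroup F] [NormedSpace ℝ F] (i : Fin n)
    (φ : EuclideanSpace ℝ (Fin n) → F) (u : EuclideanSpace ℝ (Fin n)) : F :=
  fderiv ℝ φ u (EuclideanSpace.single i 1)

/-! ### Local geometry of a parametrized hypersurface

Here `f` is a local parametrization, with values in `𝔼ᵐ_s` (`m = n + 1` for a hypersurface). -/

/-- The first fundamental form `gᵢⱼ = ⟨∂ᵢ f, ∂ⱼ f⟩` of the induced metric. -/
def metric {n m : ℕ} (s : ℕ) (f : EuclideanSpace ℝ (Fin n) → EuclideanSpace ℝ (Fin m))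
    (u : EuclideanSpace ℝ (Fin n)) : Matrix (Fin n) (Fin n) ℝ :=
  Matrix.of fun i j => scalarProduct s (pd i f u) (pd j f u)

/-- The Christoffel symbol `Γᵏᵢⱼ` of the Levi-Civita connection of the induced metric,
`∇_{∂ᵢ} ∂ⱼ = ∑ₖ Γᵏᵢⱼ ∂ₖ`. -/
def christoffel {n m : ℕ} (s : ℕ) (f : EuclideanSpace ℝ (Fin n) → EuclideanSpace ℝ (Fin m))
    (u : EuclideanSpace ℝ (Fin n)) (k i j : Fin n) : ℝ :=
  (1 / 2) * ∑ l : Fin n, (metric s f u)⁻¹ k l *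
    (pd i (fun v => metric s f v j l) u + pd j (fun v => metric s f v i l) u
      - pd l (fun v => metric s f v i j) u)

/-- The second covariant derivative `∂ᵢ ∂ⱼ φ - (∇_{∂ᵢ} ∂ⱼ) φ` of a function `φ` with values in a
vector space, with respect to the induced metric of `f`. -/
def hessian {n m : ℕ} {F : Type*} [NormedAddCommGroup F] [NormedSpace ℝ F] (s : ℕ)
    (f : EuclideanSpace ℝ (Fin n) → EuclideanSpace ℝ (Fin m))
    (φ : EuclideanSpace ℝ (Fin n) → F) (u : EuclideanSpace ℝ (Fin n)) (i j : Fin n) : F :=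
  pd i (pd j φ) u - ∑ k : Fin n, christoffel s f u k i j • pd k φ u

/-- The Laplace operator `Δ φ = - ∑ᵢⱼ gⁱʲ (∂ᵢ ∂ⱼ - ∇_{∂ᵢ} ∂ⱼ) φ` of the induced metric
(with the sign for which `Δ` is `- div grad`). On a vector field along the hypersurface it acts
through the flat connection of the ambient space, i.e. on each Cartesian component. -/
def laplacian {n m : ℕ} {F : Type*} [NormedAddCommGroup F] [NormedSpace ℝ F] (s : ℕ)
    (f : EuclideanSpace ℝ (Fin n) → EuclideanSpace ℝ (Fin m))
    (φ : EuclideanSpace ℝ (Fin n) → F) (u : EuclideanSpace ℝ (Fin n)) : F :=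
  - ∑ i : Fin n, ∑ j : Fin n, (metric s f u)⁻¹ i j • hessian s f φ u i j

/-- The vector valued second fundamental form, by the Gauss formula
`II(∂ᵢ, ∂ⱼ) = ∂ᵢ (∂ⱼ f) - df (∇_{∂ᵢ} ∂ⱼ)`: flat ambient derivative minus tangential part. -/
def secondFundamentalForm {n m : ℕ} (s : ℕ)
    (f : EuclideanSpace ℝ (Fin n) → EuclideanSpace ℝ (Fin m))
    (u : EuclideanSpace ℝ (Fin n)) (i j : Fin n) : EuclideanSpace ℝ (Fin m) :=
  hessian s f f u i j

/-- The mean curvature vector `(1 / n) ∑ᵢⱼ gⁱʲ II(∂ᵢ, ∂ⱼ)`. For a unit normal `ξ` with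
`ε = ⟨ξ, ξ⟩` and shape operator `A` it is `H ξ` with `H = (1 / n) ε tr A`. -/
def meanCurvatureVector {n m : ℕ} (s : ℕ)
    (f : EuclideanSpace ℝ (Fin n) → EuclideanSpace ℝ (Fin m))
    (u : EuclideanSpace ℝ (Fin n)) : EuclideanSpace ℝ (Fin m) :=
  (1 / (n : ℝ)) • ∑ i : Fin n, ∑ j : Fin n,
    (metric s f u)⁻¹ i j • secondFundamentalForm s f u i j

/-- `ξ` is a unit normal vector at `f u`: orthogonal to the tangent space, and `⟨ξ, ξ⟩ = ±1`.
Where the metric of a hypersurface is nondegenerate there are exactly two of them, `ξ` and `-ξ`. -/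
def IsUnitNormal {n : ℕ} (s : ℕ) (f : EuclideanSpace ℝ (Fin n) → EuclideanSpace ℝ (Fin (n + 1)))
    (u : EuclideanSpace ℝ (Fin n)) (ξ : EuclideanSpace ℝ (Fin (n + 1))) : Prop :=
  (∀ i : Fin n, scalarProduct s ξ (pd i f u) = 0) ∧
    (scalarProduct s ξ ξ = 1 ∨ scalarProduct s ξ ξ = -1)

/-- The matrix, in the basis `∂₁, …, ∂ₙ`, of the shape operator `A` associated to `ξ`:
`⟨A X, Y⟩ = ⟨II(X, Y), ξ⟩`. -/
def shapeOperator {n : ℕ} (s : ℕ) (f : EuclideanSpace ℝ (Fin n) → EuclideanSpace ℝ (Fin (n + 1)))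
    (u : EuclideanSpace ℝ (Fin n)) (ξ : EuclideanSpace ℝ (Fin (n + 1))) :
    Matrix (Fin n) (Fin n) ℝ :=
  (metric s f u)⁻¹ *
    Matrix.of fun i j => scalarProduct s (secondFundamentalForm s f u i j) ξ

/-- The set of principal curvatures: the complex eigenvalues of the shape operator. -/
def principalCurvatures {n : ℕ} (s : ℕ)
    (f : EuclideanSpace ℝ (Fin n) → EuclideanSpace ℝ (Fin (n + 1)))
    (u : EuclideanSpace ℝ (Fin n)) (ξ : EuclideanSpace ℝ (Fin (n + 1))) : Set ℂ :=
  {κ : ℂ | Module.End.HasEigenvalue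
    (Matrix.toLin' ((shapeOperator s f u ξ).map (fun a : ℝ => (a : ℂ)))) κ}

/-! ### Hypersurfaces

`M` is a smooth `n`-manifold and `x : M → 𝔼ⁿ⁺¹_s`. Geometric conditions on `x` are imposed on
the local parametrizations `x ∘ e.symm`, for every smooth chart `e` of `M`. -/

section Hypersurface

variable {n : ℕ} {M : Type*} [TopologicalSpace M] [ChartedSpace (EuclideanSpace ℝ (Fin n)) M]

/-- `x : M → 𝔼ⁿ⁺¹_s` is a nondegenerate hypersurface: `x` is smooth and the induced symmetric
bilinear form is nondegenerate at every point. (In particular `x` is an immersion, and an isometric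
one for the induced pseudo-Riemannian metric.) -/
structure IsNondegenerateHypersurface (s : ℕ) (x : M → EuclideanSpace ℝ (Fin (n + 1))) :
    Prop where
  smooth : ContMDiff (𝓡 n) 𝓘(ℝ, EuclideanSpace ℝ (Fin (n + 1))) ∞ x
  nondegenerate : ∀ e ∈ IsManifold.maximalAtlas (𝓡 n) ∞ M, ∀ u ∈ e.target,
    (metric s (x ∘ e.symm) u).det ≠ 0

/-- The mean curvature vector field is proper: `Δ H⃗ = c H⃗` on `M` for some real constant `c`. -/
def HasProperMeanCurvatureVector (s : ℕ) (x : M → EuclideanSpace ℝ (Fin (n + 1))) : Prop :=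
  ∃ c : ℝ, ∀ e ∈ IsManifold.maximalAtlas (𝓡 n) ∞ M, ∀ u ∈ e.target,
    laplacian s (x ∘ e.symm) (meanCurvatureVector s (x ∘ e.symm)) u =
      c • meanCurvatureVector s (x ∘ e.symm) u

/-- At every point there are exactly two distinct principal curvatures, and both are imaginary,
i.e. not real. (Replacing `ξ` by `-ξ` changes the sign of all principal curvatures.) -/
def HasTwoImaginaryPrincipalCurvatures (s : ℕ) (x : M → EuclideanSpace ℝ (Fin (n + 1))) : Prop :=
  ∀ e ∈ IsManifold.maximalAtlas (𝓡 n) ∞ M, ∀ u ∈ e.target,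
    ∀ ξ : EuclideanSpace ℝ (Fin (n + 1)), IsUnitNormal s (x ∘ e.symm) u ξ →
      (principalCurvatures s (x ∘ e.symm) u ξ).ncard = 2 ∧
        ∀ κ ∈ principalCurvatures s (x ∘ e.symm) u ξ, κ.im ≠ 0

/-- The hypersurface is minimal: its mean curvature vector field vanishes identically. -/
def IsMinimal (s : ℕ) (x : M → EuclideanSpace ℝ (Fin (n + 1))) : Prop :=
  ∀ e ∈ IsManifold.maximalAtlas (𝓡 n) ∞ M, ∀ u ∈ e.target,
    meanCurvatureVector s (x ∘ e.symm) u = 0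

end Hypersurface

end

end PseudoEuclidean

/-! Suppose the mean curvature vector is nonzero at some point. A nonzero normal vector of a
nondegenerate hypersurface is not null, so near that point it can be written as `r • ξ`, with `ξ` a
smooth unit normal and `r > 0`. At each point the principal curvatures are `a ± ib`, both of
algebraic multiplicity two. Hence `Q = (A - a)² + b²` satisfies `Q² = 0`, but `A` need not be
diagonalizable over ℂ.

The tangential part of `ΔH = cH` makes the gradient of `r` an eigenvector of `A` for a real number
(`exists_gradient_eigenvector`). There are no real eigenvalues, so `r` is locally constant, and so
is `a`, being a multiple of `tr A`. The normal part then gives `tr A² = εc`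
(`trace_sq_of_laplacian`), so `b²` is constant as well.

It remains to exclude constant principal curvatures `a ± ib` (`false_of_constant_imaginary`). By
Codazzi, `∇A` is a totally symmetric trilinear form. Differentiating `Q² = 0` and using this
symmetry gives `(∇Q)Q = 0` (`anticommutator_mul_eq_zero`). Where `Q ≠ 0`, one more derivative and
the Ricci identity give `Q R(X,Y) Q = 0`, which the Gauss equation forbids
(`eq_zero_of_curvature_image`). So `Q = 0`, and differentiating this equation forces `∇A = 0`
(`eq_zero_of_anticommute`). The curvature then commutes with `A`, which again contradicts Gauss
(`false_of_curvature_commute`). -/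

namespace PseudoEuclidean

/-! ### Algebra of symmetric first variations of an operator with `(P² + b²)² = 0` -/

section LinearAlgebra

variable {V : Type*} [NormedAddCommGroup V] [NormedSpace ℝ V]

/-- On the kernel of `P² + b²` with `b ≠ 0`, the vectors `w` and `P w` are linearly independent. -/
lemma eq_zero_of_smul_add_smul_eq_zero {P Q : V →L[ℝ] V} {b : ℝ} (hb : b ≠ 0)
    (hQ : Q = P * P + b ^ 2 • 1) {w : V} (hw : Q w = 0) {α β : ℝ}
    (h : α • w + β • P w = 0) (hw0 : w ≠ 0) : α = 0 ∧ β = 0 := by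
  have hPP : P (P w) = -(b ^ 2 • w) := by
    have := hw
    rw [hQ] at this
    simp at this
    exact eq_neg_of_add_eq_zero_left this
  have h1 : α • P w - (β * b ^ 2) • w = 0 := by
    have := congrArg P h
    simp only [map_add, map_smul, hPP, map_zero] at this
    rw [← this]; module
  have h2 : (α ^ 2 + β ^ 2 * b ^ 2) • w = 0 := by
    have : (α ^ 2 + β ^ 2 * b ^ 2) • w
        = α • (α • w + β • P w) - β • (α • P w - (β * b ^ 2) • w) := by module
    rw [this, h, h1]; simp
  have h3 := (smul_eq_zero.mp h2).resolve_right hw0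
  have hα : α = 0 := by
    have : 0 ≤ β ^ 2 * b ^ 2 := by positivity
    nlinarith [sq_nonneg α]
  refine ⟨hα, ?_⟩
  subst hα
  have : β ^ 2 * b ^ 2 = 0 := by linarith
  simpa [hb] using this

lemma commute_of_eq_sq_add {P Q : V →L[ℝ] V} {b : ℝ} (hQ : Q = P * P + b ^ 2 • 1) (v : V) :
    Q (P v) = P (Q v) := by
  simp [hQ]

lemma apply_apply_of_eq_sq_add {P Q : V →L[ℝ] V} {b : ℝ} (hQ : Q = P * P + b ^ 2 • 1) (v : V) :
    P (P v) = Q v - b ^ 2 • v := by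
  simp [hQ]

/-- In the non-semisimple case any vector outside `ker Q` is cyclic for `P`. Applying `Q` to a
linear relation kills the terms in `Q w`, `P (Q w)` and leaves one in `ker Q`, where `P` acts as `b`
times a complex structure. Four independent vectors fill the space. -/
lemma exists_cyclic_decomposition (hV : Module.finrank ℝ V = 4) {P Q : V →L[ℝ] V} {b : ℝ}
    (hb : b ≠ 0) (hQ : Q = P * P + b ^ 2 • 1) (hQQ : ∀ v, Q (Q v) = 0) {w : V} (hw : Q w ≠ 0)
    (z : V) : ∃ a₀ a₁ a₂ a₃ : ℝ,
      z = a₀ • w + a₁ • P w + a₂ • Q w + a₃ • P (Q w) := by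
  have hli : LinearIndependent ℝ ![w, P w, Q w, P (Q w)] := by
    rw [Fintype.linearIndependent_iff]
    intro a ha
    simp only [Fin.sum_univ_four, Matrix.cons_val] at ha
    have h0 : a 0 • Q w + a 1 • P (Q w) = 0 := by
      have := congrArg Q ha
      simpa [commute_of_eq_sq_add hQ, hQQ] using this
    obtain ⟨h0, h1⟩ := eq_zero_of_smul_add_smul_eq_zero hb hQ (hQQ w) h0 hw
    rw [h0, h1] at ha
    obtain ⟨h2, h3⟩ := eq_zero_of_smul_add_smul_eq_zero hb hQ (hQQ w) (by simpa using ha) hw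
    intro i
    fin_cases i <;> assumption
  have : FiniteDimensional ℝ V := FiniteDimensional.of_finrank_pos (by omega)
  have hspan := hli.span_eq_top_of_card_eq_finrank' (by simp [hV])
  have hz : z ∈ Submodule.span ℝ (Set.range ![w, P w, Q w, P (Q w)]) := by
    rw [hspan]; trivial
  obtain ⟨a, rfl⟩ := (Submodule.mem_span_range_iff_exists_fun ℝ).mp hz
  exact ⟨a 0, a 1, a 2, a 3, by simp [Fin.sum_univ_four]⟩

/-- If `X ↦ C X` is a totally symmetric first variation of `P` along which `Q = P² + b²` stays
of square zero, then the induced variation of `Q` vanishes on the image of `Q`. -/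
lemma anticommutator_mul_eq_zero (hV : Module.finrank ℝ V = 4) {P Q : V →L[ℝ] V} {b : ℝ}
    (hb : b ≠ 0) (hQ : Q = P * P + b ^ 2 • 1) (hQQ : Q * Q = 0)
    {g : V →L[ℝ] V →L[ℝ] ℝ} (hg : ∀ X, (∀ Y, g X Y = 0) → X = 0)
    (hP : ∀ X Y, g (P X) Y = g X (P Y))
    {C : V → V →L[ℝ] V} (hC : ∀ X Y, C X Y = C Y X) (hgC : ∀ X Y Z, g (C X Y) Z = g Y (C X Z))
    (hsymm : ∀ X Y, g X Y = g Y X)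
    (h : ∀ X, Q * (P * C X + C X * P) + (P * C X + C X * P) * Q = 0) (X : V) :
    (P * C X + C X * P) * Q = 0 := by
  by_cases hQ0 : Q = 0
  · simp [hQ0]
  obtain ⟨w, hw⟩ : ∃ w, Q w ≠ 0 := by
    by_contra! hcon
    exact hQ0 (ContinuousLinearMap.ext hcon)
  have hQQ' : ∀ v, Q (Q v) = 0 := fun v => by simpa using DFunLike.congr_fun hQQ v
  have hQP := commute_of_eq_sq_add hQ
  have hPP := apply_apply_of_eq_sq_add hQ
  have hQs : ∀ X Y, g (Q X) Y = g X (Q Y) := fun X Y => by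
    simp [hQ, hP]
  set c : V → V → V → ℝ := fun X Y Z => g (C X Y) Z with hc
  have c12 : ∀ X Y Z, c X Y Z = c Y X Z := fun X Y Z => by simp only [hc, hC X Y]
  have c23 : ∀ X Y Z, c X Y Z = c X Z Y := fun X Y Z => by
    simp only [hc]; rw [hgC, hsymm]
  have cadd : ∀ X Y Z Z', c X Y (Z + Z') = c X Y Z + c X Y Z' := fun X Y Z Z' => by simp [hc]
  have csub : ∀ X Y Z Z', c X Y (Z - Z') = c X Y Z - c X Y Z' := fun X Y Z Z' => by simp [hc]
  have csmul : ∀ X Y (r : ℝ) Z, c X Y (r • Z) = r * c X Y Z := fun X Y r Z => by simp [hc]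
  have cneg : ∀ X Y Z, c X Y (-Z) = - c X Y Z := fun X Y Z => by simp [hc]
  have c0 : ∀ X Y, c X Y 0 = 0 := fun X Y => by simp [hc]
  have cadd' : ∀ X Y Y' Z, c X (Y + Y') Z = c X Y Z + c X Y' Z := fun X Y Y' Z => by simp [hc]
  have csmul' : ∀ X (r : ℝ) Y Z, c X (r • Y) Z = r * c X Y Z := fun X r Y Z => by simp [hc]
  have cneg' : ∀ X Y Z, c X (-Y) Z = - c X Y Z := fun X Y Z => by simp [hc]
  -- The differentiated equation paired with `Z`, with `P` and `Q` moved across `g`. The next four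
  -- identities evaluate it on pairs from the cyclic basis, using symmetry in the last two slots
  -- only.
  have star : ∀ X Y Z, c X Y (P (Q Z)) + c X (P Y) (Q Z) + c X (Q Y) (P Z)
      + c X (P (Q Y)) Z = 0 := fun X Y Z => by
    have := congrArg (fun T : V →L[ℝ] V => g (T Y) Z) (h X)
    simp only [_root_.add_apply, ContinuousLinearMap.mul_def, ContinuousLinearMap.comp_apply, map_add,
      _root_.zero_apply, map_zero, hQs, hP] at this
    simp only [hc]
    linarith
  have s00 : ∀ X, c X w (P (Q w)) + c X (P w) (Q w) = 0 := fun X => by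
    have := star X w w
    rw [c23 X (Q w), c23 X (P (Q w))] at this
    linarith
  have s01 : ∀ X, -2 * b ^ 2 * c X w (Q w) + 2 * c X (P w) (P (Q w)) + c X (Q w) (Q w) = 0 :=
    fun X => by
      have := star X w (P w)
      simp only [hQP, hPP, hQQ', csub, csmul, c0] at this
      rw [c23 X (Q w) w, c23 X (P (Q w))] at this
      linarith
  have s02 : ∀ X, c X (Q w) (P (Q w)) = 0 := fun X => by
    have := star X w (Q w)
    simp only [hQQ', map_zero, c0] at this
    rw [c23 X (P (Q w))] at this
    linarith
  have s12 : ∀ X, c X (P (Q w)) (P (Q w)) = b ^ 2 * c X (Q w) (Q w) := fun X => by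
    have := star X (P w) (Q w)
    simp only [hQP, hPP, hQQ', map_zero, c0, csmul', zero_sub, cneg'] at this
    linarith
  -- Here total symmetry enters: `Q w` or `P (Q w)` is put in the free slot of the basis identities
  -- and the slots are permuted. This shows that the form vanishes on two copies of `Q w` and any
  -- basis vector, which the identities alone do not give.
  have k2 : c (Q w) (Q w) (Q w) = 0 := by
    have h1 := s12 (Q w)
    rw [c12 (Q w), s02] at h1
    simpa [hb] using h1.symm
  have k3 : c (P (Q w)) (Q w) (Q w) = 0 := by rw [c12, c23, s02]
  have k0 : c w (Q w) (Q w) = 0 := by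
    have h1 := s01 (Q w)
    rw [k2, c12 (Q w) (P w), s02, c12 (Q w) w] at h1
    have : b ^ 2 * c w (Q w) (Q w) = 0 := by linarith
    simpa [hb] using this
  have k1 : c (P w) (Q w) (Q w) = 0 := by
    have h1 := s01 (P (Q w))
    rw [k3, c12 _ (P w), s12, c12 _ w, c23, s02] at h1
    have : b ^ 2 * c (P w) (Q w) (Q w) = 0 := by linarith
    simpa [hb] using this
  have k : ∀ X, c X (Q w) (Q w) = 0 := fun X => by
    obtain ⟨a₀, a₁, a₂, a₃, rfl⟩ := exists_cyclic_decomposition hV hb hQ hQQ' hw X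
    rw [c12, c23]
    simp only [cadd, csmul]
    rw [c23 _ _ w, c23 _ _ (P w), c23 _ _ (P (Q w)), c12 _ w, c12 _ (P w), c12 _ (P (Q w)),
      k0, k1, k2, k3]
    ring
  have key : ∀ Y Z, c X (Q Y) (P Z) + c X (P (Q Y)) Z = 0 := fun Y Z => by
    obtain ⟨a₀, a₁, a₂, a₃, rfl⟩ := exists_cyclic_decomposition hV hb hQ hQQ' hw Z
    obtain ⟨d₀, d₁, d₂, d₃, rfl⟩ := exists_cyclic_decomposition hV hb hQ hQQ' hw Y
    have e : Q (d₀ • w + d₁ • P w + d₂ • Q w + d₃ • P (Q w)) = d₀ • Q w + d₁ • P (Q w) := by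
      simp [hQP, hQQ']
    have hPPQ : P (P (Q w)) = - (b ^ 2 • Q w) := by rw [hPP, hQQ']; simp
    rw [e]
    simp only [map_add, map_smul, hPPQ, hPP, cadd, csmul, csub, cneg, cadd', csmul', cneg']
    have e1 := s00 X
    have e2 := s01 X
    have e3 := s02 X
    have e4 := s12 X
    have e5 := k X
    rw [c23 X (Q w) w, c23 X (Q w) (P w), c23 X (P (Q w)) w, c23 X (P (Q w)) (P w),
      c23 X (P (Q w)) (Q w), e3, e4, e5]
    rw [e5] at e2
    have e6 : c X w (P (Q w)) = - c X (P w) (Q w) := by linarith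
    have e7 : c X (P w) (P (Q w)) = b ^ 2 * c X w (Q w) := by linarith
    rw [e6, e7]
    ring
  ext Y
  refine hg _ fun Z => ?_
  have := key Y Z
  simp only [hc] at this
  simp only [_root_.add_apply, ContinuousLinearMap.mul_def, ContinuousLinearMap.comp_apply, map_add, hP]
  linarith

/-- The semisimple case: the variation vanishes. -/
lemma eq_zero_of_anticommute {P : V →L[ℝ] V} {b : ℝ}
    (hb : b ≠ 0) (hQ : P * P + b ^ 2 • 1 = 0)
    {g : V →L[ℝ] V →L[ℝ] ℝ} (hg : ∀ X, (∀ Y, g X Y = 0) → X = 0)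
    (hP : ∀ X Y, g (P X) Y = g X (P Y))
    (hsymm : ∀ X Y, g X Y = g Y X)
    {C : V → V →L[ℝ] V} (hC : ∀ X Y, C X Y = C Y X) (hgC : ∀ X Y Z, g (C X Y) Z = g Y (C X Z))
    (h : ∀ X, P * C X + C X * P = 0) (X : V) : C X = 0 := by
  have h' : ∀ X Y, P (C X Y) = - C X (P Y) := fun X Y => by
    have := DFunLike.congr_fun (h X) Y
    simpa [add_eq_zero_iff_eq_neg] using this
  have hPP : ∀ v, P (P v) = - (b ^ 2 • v) := fun v => by
    have := DFunLike.congr_fun hQ v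
    simpa [add_eq_zero_iff_eq_neg] using this
  set c : V → V → V → ℝ := fun X Y Z => g (C X Y) Z with hc
  have c12 : ∀ X Y Z, c X Y Z = c Y X Z := fun X Y Z => by simp only [hc, hC X Y]
  have c23 : ∀ X Y Z, c X Y Z = c X Z Y := fun X Y Z => by
    simp only [hc]; rw [hgC, hsymm]
  -- Moving `P` from one slot to another changes the sign. Carrying it around all three slots takes
  -- three moves, so the value equals its own negative.
  have star : ∀ X Y Z, c X Y (P Z) = - c X (P Y) Z := fun X Y Z => by
    simp only [hc]; rw [← hP, h']; simp
  have h1 : ∀ X Y, C X (P Y) = 0 := fun X Y => by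
    refine hg _ fun Z => ?_
    have e1 := star X Y Z
    have e2 := star Y X Z
    have e3 := star Z X Y
    rw [c12 Y X, c12 Y (P X)] at e2
    rw [c12 Z X, c23 X Z, c12 Z (P X), c23 (P X) Z] at e3
    change c X (P Y) Z = 0
    linarith
  ext Y
  have := h1 X (P Y)
  rw [hPP] at this
  simpa [hb] using this

end LinearAlgebra

/-! ### Algebraic contradictions from the Gauss equation, and the spectrum of a real 4 × 4 matrix -/

section LinearAlgebra

variable {V : Type*} [NormedAddCommGroup V] [NormedSpace ℝ V]

lemma eq_zero_of_smul_add_smul_eq_zero' {P Q : V →L[ℝ] V} {b : ℝ} (hb : b ≠ 0)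
    (hQ : Q = P * P + b ^ 2 • 1) (hQQ : ∀ v, Q (Q v) = 0) {w : V} {α β : ℝ}
    (h : α • w + β • P w = 0) (hw0 : w ≠ 0) : α = 0 ∧ β = 0 := by
  by_cases hw : Q w = 0
  · exact eq_zero_of_smul_add_smul_eq_zero hb hQ hw h hw0
  · refine eq_zero_of_smul_add_smul_eq_zero hb hQ (hQQ w) ?_ hw
    have := congrArg Q h
    simpa [commute_of_eq_sq_add hQ] using this

/-- An eigenvector with real eigenvalue would be a dependence between `w` and `P w`. The case `c =
0` gives injectivity of `A`; general `c` is applied to the gradient of the mean curvature. -/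
lemma eq_zero_of_apply_eq_smul {A P Q : V →L[ℝ] V} {a b c : ℝ} (hA : A = P + a • 1) (hb : b ≠ 0)
    (hQ : Q = P * P + b ^ 2 • 1) (hQQ : ∀ v, Q (Q v) = 0) {w : V} (h : A w = c • w) : w = 0 := by
  by_contra hw
  have := eq_zero_of_smul_add_smul_eq_zero' (α := a - c) (β := 1) hb hQ hQQ (w := w) (by
    have : P w + a • w = c • w := by simpa [hA] using h
    rw [sub_smul, ← this]; module) hw
  exact one_ne_zero this.2

/-- The last hypothesis is `Q R(X,Y) Q = 0` after the Gauss equation. For `X = w`, `Y = P w`,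
injectivity of `A` and independence of `Q w`, `P (Q w)` show that `A (Q Z)` is orthogonal to `w` and
`P w`. It is orthogonal to the image of `Q` because `Q` is self-adjoint of square zero. Hence it is
orthogonal to the whole cyclic basis. -/
lemma eq_zero_of_curvature_image {A P Q : V →L[ℝ] V} {a b : ℝ}
    (hV : Module.finrank ℝ V = 4) (hA : A = P + a • 1) (hb : b ≠ 0)
    (hQ : Q = P * P + b ^ 2 • 1) (hQQ : ∀ v, Q (Q v) = 0)
    {g : V →L[ℝ] V →L[ℝ] ℝ} (hg : ∀ X, (∀ Y, g X Y = 0) → X = 0)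
    (hAg : ∀ X Y, g (A X) Y = g X (A Y)) (hsymm : ∀ X Y, g X Y = g Y X)
    (h : ∀ X Y Z, Q (g (A Y) (Q Z) • A X - g (A X) (Q Z) • A Y) = 0) : Q = 0 := by
  by_contra hQ0
  obtain ⟨w, hw⟩ : ∃ w, Q w ≠ 0 := by
    by_contra! hcon
    exact hQ0 (ContinuousLinearMap.ext hcon)
  have hinj : ∀ v, A v = 0 → v = 0 := fun v hv =>
    eq_zero_of_apply_eq_smul (c := 0) hA hb hQ hQQ (by simpa using hv)
  have hQP := commute_of_eq_sq_add hQ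
  have hQA : ∀ v, Q (A v) = A (Q v) := fun v => by simp [hA, hQP]
  have hP : ∀ X Y, g (P X) Y = g X (P Y) := fun X Y => by
    have := hAg X Y
    simpa [hA] using this
  have hQs : ∀ X Y, g (Q X) Y = g X (Q Y) := fun X Y => by simp [hQ, hP]
  have hz : ∀ Z, A (Q Z) = 0 := fun Z => by
    have h1 : A (g (A (P w)) (Q Z) • Q w + (- g (A w) (Q Z)) • P (Q w)) = 0 := by
      have := h w (P w) Z
      rw [map_sub, map_smul, map_smul, hQA, hQA, hQP] at this
      rw [map_add, map_smul, map_smul, ← this]; module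
    obtain ⟨e1, e2⟩ := eq_zero_of_smul_add_smul_eq_zero' hb hQ hQQ (hinj _ h1) hw
    rw [neg_eq_zero] at e2
    refine hg _ fun Y => ?_
    obtain ⟨a₀, a₁, a₂, a₃, rfl⟩ := exists_cyclic_decomposition hV hb hQ hQQ hw Y
    have e3 : ∀ v, g (A (Q Z)) (Q v) = 0 := fun v => by
      rw [← hQs, hQA, hQQ]; simp
    rw [hsymm, ← hAg] at e1 e2
    have e4 := e3 w
    have e5 := e3 (P w)
    rw [hQP] at e5
    simp only [map_add, map_smul, e1, e2, e4, e5]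
    simp
  exact hw (hinj _ (hz w))

/-- The last hypothesis is `R(X,Y) A = A R(X,Y)` after the Gauss equation. Cancelling the injective
`A` leaves a relation among `X`, `P X`, `Y`, `P Y`. With `Y` outside the `P`-invariant plane of `X`,
its `P Y` coefficient `g (A X) Z` must vanish for every `Z`. -/
lemma false_of_curvature_commute {A P : V →L[ℝ] V} {a b : ℝ}
    (hV : Module.finrank ℝ V = 4) (hA : A = P + a • 1) (hb : b ≠ 0)
    (hQ : P * P + b ^ 2 • 1 = 0)
    {g : V →L[ℝ] V →L[ℝ] ℝ} (hg : ∀ X, (∀ Y, g X Y = 0) → X = 0)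
    (h : ∀ X Y Z, g (A Y) (A Z) • A X - g (A X) (A Z) • A Y
      = A (g (A Y) Z • A X - g (A X) Z • A Y)) : False := by
  have hnd : ∀ {w : V} {α β : ℝ}, α • w + β • P w = 0 → w ≠ 0 → α = 0 ∧ β = 0 := fun h hw =>
    eq_zero_of_smul_add_smul_eq_zero' hb hQ.symm (by simp) h hw
  have hPP : ∀ v, P (P v) = - (b ^ 2 • v) := fun v => by
    have := DFunLike.congr_fun hQ v
    simpa [add_eq_zero_iff_eq_neg] using this
  have hinj : ∀ v, A v = 0 → v = 0 := fun v hv =>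
    eq_zero_of_apply_eq_smul (Q := 0) (c := 0) hA hb hQ.symm (by simp) (by simpa using hv)
  have : Nontrivial V := Module.nontrivial_of_finrank_pos (R := ℝ) (by omega)
  have : FiniteDimensional ℝ V := FiniteDimensional.of_finrank_pos (by omega)
  obtain ⟨X, hX⟩ := exists_ne (0 : V)
  set S := Submodule.span ℝ (Set.range ![X, P X]) with hS
  have hmem : ∀ v, v ∈ S ↔ ∃ α β : ℝ, α • X + β • P X = v := fun v => by
    rw [hS, Submodule.mem_span_range_iff_exists_fun]
    constructor
    · rintro ⟨c, rfl⟩; exact ⟨c 0, c 1, by simp⟩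
    · rintro ⟨α, β, rfl⟩; exact ⟨![α, β], by simp⟩
  obtain ⟨Y, hY⟩ : ∃ Y, Y ∉ S := by
    by_contra! hcon
    have h1 : S = ⊤ := by ext v; simp [hcon v]
    have h2 := finrank_range_le_card (R := ℝ) ![X, P X]
    rw [Set.finrank, ← hS, h1, finrank_top, hV] at h2
    simp at h2
  have hSP : ∀ v ∈ S, P v ∈ S := fun v hv => by
    obtain ⟨α, β, rfl⟩ := (hmem v).mp hv
    refine (hmem _).mpr ⟨- (β * b ^ 2), α, ?_⟩
    simp only [map_add, map_smul, hPP]; module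
  -- Multiplication by the conjugate `γ - δP` turns the combination into the real multiple `γ² +
  -- δ²b²` of `Y`.
  have hYS : ∀ γ δ : ℝ, γ • Y + δ • P Y ∈ S → δ = 0 := fun γ δ hm => by
    have h1 : (γ ^ 2 + δ ^ 2 * b ^ 2) • Y ∈ S := by
      have := S.sub_mem (S.smul_mem γ hm) (S.smul_mem δ (hSP _ hm))
      simp only [map_add, map_smul, hPP] at this
      convert this using 1; module
    have h2 : γ ^ 2 + δ ^ 2 * b ^ 2 = 0 := by
      by_contra hne
      exact hY ((S.smul_mem_iff hne).mp h1)
    have : δ ^ 2 * b ^ 2 = 0 := by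
      have h3 : 0 ≤ δ ^ 2 * b ^ 2 := by positivity
      nlinarith [sq_nonneg γ]
    simpa [hb] using this
  have hz : ∀ Z, g (A X) Z = 0 := fun Z => by
    have h1 := h X Y Z
    rw [← map_smul, ← map_smul, ← map_sub, ← sub_eq_zero, ← map_sub] at h1
    have h2 := hinj _ h1
    refine hYS (g (A X) Z * a - g (A X) (A Z)) _ ((hmem _).mpr
      ⟨g (A Y) Z * a - g (A Y) (A Z), g (A Y) Z, ?_⟩)
    rw [← sub_eq_zero, ← neg_eq_zero, ← h2]
    simp only [hA, _root_.add_apply, _root_.smul_apply, one_apply_eq_self]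
    module
  exact hX (hinj _ (hg _ hz))

/-- A real `4 × 4` matrix with exactly two complex eigenvalues, both imaginary. -/
lemma exists_of_two_imaginary_eigenvalues (M : Matrix (Fin 4) (Fin 4) ℝ)
    (h2 : {κ : ℂ | Module.End.HasEigenvalue
      (Matrix.toLin' (M.map (fun a : ℝ => (a : ℂ)))) κ}.ncard = 2)
    (him : ∀ κ ∈ {κ : ℂ | Module.End.HasEigenvalue
      (Matrix.toLin' (M.map (fun a : ℝ => (a : ℂ)))) κ}, κ.im ≠ 0) :
    ∃ a b : ℝ, b ≠ 0 ∧
      ((M - a • 1) * (M - a • 1) + b ^ 2 • 1) * ((M - a • 1) * (M - a • 1) + b ^ 2 • 1) = 0 ∧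
      M.trace = 4 * a ∧ (M * M).trace = 4 * (a ^ 2 - b ^ 2) := by
  open Polynomial in
  set S := {κ : ℂ | Module.End.HasEigenvalue
      (Matrix.toLin' (M.map (fun a : ℝ => (a : ℂ)))) κ} with hS
  have hmem : ∀ κ : ℂ, κ ∈ S ↔ aeval κ M.charpoly = 0 := fun κ => by
    rw [hS, Set.mem_ofPred_eq, Module.End.hasEigenvalue_iff_isRoot_charpoly, Matrix.charpoly_toLin']
    have : M.map (fun a : ℝ => (a : ℂ)) = M.map (algebraMap ℝ ℂ) := rfl
    rw [this, Matrix.charpoly_map, IsRoot.def, eval_map_algebraMap]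
  have hconj : ∀ κ ∈ S, (starRingEnd ℂ) κ ∈ S := fun κ hκ => by
    rw [hmem] at hκ ⊢
    rw [aeval_conj, hκ, map_zero]
  obtain ⟨μ, hμ⟩ : S.Nonempty := by
    rw [Set.nonempty_iff_ne_empty]; rintro h; rw [h] at h2; simp at h2
  have hμ0 := him μ hμ
  have hSfin : S.Finite := Set.finite_of_ncard_ne_zero (by omega)
  have hSeq : {μ, (starRingEnd ℂ) μ} = S := by
    refine Set.eq_of_subset_of_ncard_le ?_ ?_ hSfin
    · rintro z (rfl | rfl)
      exacts [hμ, hconj _ hμ]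
    · rw [h2, Set.ncard_pair]
      intro h
      exact hμ0 (Complex.conj_eq_iff_im.mp h.symm)
  set q : ℝ[X] := X ^ 2 - C (2 * μ.re) * X + C (‖μ‖ ^ 2) with hq
  have hqm : q.Monic := by rw [hq]; monicity!
  have hqd : q.natDegree = 2 := by rw [hq]; compute_degree!
  have hdvd : ∀ p : ℝ[X], aeval μ p = 0 → q ∣ p := fun p hp =>
    p.quadratic_dvd_of_aeval_eq_zero_im_ne_zero hp hμ0
  obtain ⟨r, hr⟩ := hdvd _ ((hmem μ).mp hμ)
  have hχm := M.charpoly_monic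
  have hχd := M.charpoly_natDegree_eq_dim
  have hrm : r.Monic := hqm.of_mul_monic_left (hr ▸ hχm)
  have hrd : r.natDegree = 2 := by
    rw [hr, hqm.natDegree_mul hrm, hqd] at hχd
    simp at hχd; omega
  -- The quadratic cofactor has a complex root, which must be `μ` or its conjugate as there are no
  -- other eigenvalues. So the cofactor is again `q`, and the characteristic polynomial is `q²`.
  obtain ⟨ν, hν⟩ : ∃ ν : ℂ, aeval ν r = 0 :=
    IsAlgClosed.exists_aeval_eq_zero ℂ r (by
      intro h; rw [natDegree_eq_of_degree_eq_some h] at hrd; simp at hrd)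
  have hνS : ν ∈ S := by rw [hmem, hr, map_mul, hν, mul_zero]
  have hμr : aeval μ r = 0 := by
    rw [← hSeq] at hνS
    rcases hνS with h | h
    · rwa [← h]
    · rw [Set.mem_singleton_iff] at h
      rw [h, aeval_conj] at hν
      simpa using hν
  have hrq : r = q := by
    obtain ⟨t, ht⟩ := hdvd r hμr
    have htm : t.Monic := hqm.of_mul_monic_left (ht ▸ hrm)
    have : t.natDegree = 0 := by
      rw [ht, hqm.natDegree_mul htm, hqd] at hrd; omega
    rw [ht, htm.natDegree_eq_zero.mp this, mul_one]
  have hCH := M.aeval_self_charpoly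
  have hnorm : ‖μ‖ ^ 2 = μ.re ^ 2 + μ.im ^ 2 := by
    rw [← Complex.normSq_eq_norm_sq, Complex.normSq_apply]; ring
  have hqM : aeval M q = (M - μ.re • 1) * (M - μ.re • 1) + μ.im ^ 2 • 1 := by
    rw [hq, hnorm]
    simp only [map_add, map_sub, map_mul, map_pow, aeval_X, aeval_C, Algebra.algebraMap_eq_smul_one]
    simp only [sub_mul, mul_sub, smul_mul_assoc, mul_smul_comm, one_mul, mul_one, pow_two]
    module
  have hχ : M.charpoly = q * q := by rw [hr, hrq]
  have htr : M.trace = 4 * μ.re := by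
    rw [Matrix.trace_eq_neg_charpoly_coeff, hχ]
    have : q * q = X ^ 4 + C (-4 * μ.re) * X ^ 3 +
      (C (4 * μ.re ^ 2 + 2 * ‖μ‖ ^ 2) * X ^ 2 + C (-4 * μ.re * ‖μ‖ ^ 2) * X +
        C (‖μ‖ ^ 4)) := by
      rw [hq]; simp only [map_add, map_mul, map_pow, map_neg, map_ofNat]; ring
    have hc : ∀ c₃ c₂ c₁ c₀ : ℝ,
        (X ^ 4 + C c₃ * X ^ 3 + (C c₂ * X ^ 2 + C c₁ * X + C c₀)).coeff 3 = c₃ := by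
      intros; simp
    rw [this, Fintype.card_fin, show 4 - 1 = 3 from rfl, hc]
    ring
  rw [hχ, map_mul, hqM] at hCH
  refine ⟨μ.re, μ.im, hμ0, hCH, htr, ?_⟩
  -- A nilpotent matrix has trace zero; expanding this yields the trace of `M²` from that of `M`.
  have hnil : ((M - μ.re • 1) * (M - μ.re • 1) + μ.im ^ 2 • 1).trace = 0 := by
    have : IsNilpotent ((M - μ.re • 1) * (M - μ.re • 1) + μ.im ^ 2 • 1) :=
      ⟨2, by rw [pow_two, hCH]⟩
    exact (Matrix.isNilpotent_trace_of_isNilpotent this).eq_zero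
  simp only [sub_mul, mul_sub, smul_mul_assoc, mul_smul_comm, one_mul, mul_one, Matrix.trace_add,
    Matrix.trace_sub, Matrix.trace_smul, Matrix.trace_one, htr, smul_eq_mul, Fintype.card_fin]
    at hnil
  push_cast at hnil
  linarith

end LinearAlgebra

noncomputable section

/-- When `Q ≠ 0`, kernel and image of `Q` coincide: in the cyclic basis both are spanned by `Q w`
and `P (Q w)`. -/
lemma exists_eq_apply_of_apply_eq_zero {V : Type*} [NormedAddCommGroup V] [NormedSpace ℝ V]
    (hV : Module.finrank ℝ V = 4) {P Q : V →L[ℝ] V} {b : ℝ}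
    (hb : b ≠ 0) (hQ : Q = P * P + b ^ 2 • 1) (hQQ : ∀ v, Q (Q v) = 0) {w : V} (hw : Q w ≠ 0)
    {z : V} (hz : Q z = 0) : ∃ t, z = Q t := by
  obtain ⟨a₀, a₁, a₂, a₃, rfl⟩ := exists_cyclic_decomposition hV hb hQ hQQ hw z
  have h0 : a₀ • Q w + a₁ • P (Q w) = 0 := by
    simpa [commute_of_eq_sq_add hQ, hQQ] using hz
  obtain ⟨rfl, rfl⟩ := eq_zero_of_smul_add_smul_eq_zero hb hQ (hQQ w) h0 hw
  exact ⟨a₂ • w + a₃ • P w, by simp [commute_of_eq_sq_add hQ]⟩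

/-! ### Differentiation of operator-valued maps -/

section Calculus

variable {V E F : Type*} [NormedAddCommGroup V] [NormedSpace ℝ V]
  [NormedAddCommGroup E] [NormedSpace ℝ E] [NormedAddCommGroup F] [NormedSpace ℝ F]

lemma fderiv_clm_apply_apply {c : V → E →L[ℝ] F} {v : V → E} {u : V}
    (hc : DifferentiableAt ℝ c u) (hv : DifferentiableAt ℝ v u) (X : V) :
    fderiv ℝ (fun y => c y (v y)) u X = fderiv ℝ c u X (v u) + c u (fderiv ℝ v u X) := by
  rw [fderiv_clm_apply hc hv]
  simp [add_comm]

lemma fderiv_clm_apply_const {c : V → E →L[ℝ] F} {u : V}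
    (hc : DifferentiableAt ℝ c u) (v : E) (X : V) :
    fderiv ℝ (fun y => c y v) u X = fderiv ℝ c u X v := by
  rw [fderiv_clm_apply_apply hc (differentiableAt_const v)]
  simp

lemma fderiv_congr_of_isOpen {U : Set V} (hU : IsOpen U) {f g : V → F}
    (h : ∀ u ∈ U, f u = g u) {u : V} (hu : u ∈ U) : fderiv ℝ f u = fderiv ℝ g u :=
  Filter.EventuallyEq.fderiv_eq (Filter.eventually_of_mem (hU.mem_nhds hu) h)

lemma fderiv_fderiv_comm {f : V → F} {u : V} (hf : ContDiffAt ℝ ∞ f u) (X Y : V) :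
    fderiv ℝ (fderiv ℝ f) u X Y = fderiv ℝ (fderiv ℝ f) u Y X :=
  (hf.isSymmSndFDerivAt (by
    rw [minSmoothness_of_isRCLikeNormedField]; exact WithTop.coe_le_coe.mpr (le_top : (2 : ℕ∞) ≤ ⊤))).eq X Y

lemma ContDiffAt.fderiv_infty {f : V → F} {u : V} (hf : ContDiffAt ℝ ∞ f u) :
    ContDiffAt ℝ ∞ (fderiv ℝ f) u :=
  hf.fderiv_right (by simp)

end Calculus

/-! ### Covariant derivatives of endomorphism fields and the Ricci identity -/

section CovariantDerivative

variable {V 𝔸 : Type*} [NormedAddCommGroup V] [NormedSpace ℝ V] [NormedRing 𝔸]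
  [NormedAlgebra ℝ 𝔸]

/-- The covariant derivative of a field of endomorphisms, for the connection form `Γ`. -/
def covD (Γ : V → V →L[ℝ] 𝔸) (S : V → 𝔸) (u X : V) : 𝔸 :=
  fderiv ℝ S u X + Γ u X * S u - S u * Γ u X

/-- The curvature of the connection form `Γ` in the directions of two constant vector fields. -/
def curvature (Γ : V → V →L[ℝ] 𝔸) (u X Y : V) : 𝔸 :=
  fderiv ℝ Γ u X Y - fderiv ℝ Γ u Y X + Γ u X * Γ u Y - Γ u Y * Γ u X

lemma covD_mul (Γ : V → V →L[ℝ] 𝔸) {S T : V → 𝔸} {u : V} (hS : DifferentiableAt ℝ S u)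
    (hT : DifferentiableAt ℝ T u) (X : V) :
    covD Γ (fun y => S y * T y) u X = covD Γ S u X * T u + S u * covD Γ T u X := by
  simp only [covD, fderiv_fun_mul' hS hT, _root_.add_apply, _root_.smul_apply, smul_eq_mul,
    MulOpposite.smul_eq_mul_unop, MulOpposite.unop_op]
  noncomm_ring

lemma covD_add_smul_one (Γ : V → V →L[ℝ] 𝔸) {S : V → 𝔸} {u : V}
    (c : ℝ) (X : V) :
    covD Γ (fun y => S y + c • 1) u X = covD Γ S u X := by
  simp only [covD, fderiv_add_const]
  simp only [mul_add, add_mul, smul_mul_assoc, mul_smul_comm, one_mul, mul_one]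
  abel

lemma covD_congr (Γ : V → V →L[ℝ] 𝔸) {U : Set V} (hU : IsOpen U) {S T : V → 𝔸}
    (h : ∀ u ∈ U, S u = T u) {u : V} (hu : u ∈ U) (X : V) : covD Γ S u X = covD Γ T u X := by
  simp only [covD, fderiv_congr_of_isOpen hU h hu, h u hu]

lemma covD_zero (Γ : V → V →L[ℝ] 𝔸) (u X : V) : covD Γ (fun _ => 0) u X = 0 := by
  simp [covD]

lemma ContDiffAt.covD {Γ : V → V →L[ℝ] 𝔸} {S : V → 𝔸} {u : V} (hΓ : ContDiffAt ℝ ∞ Γ u)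
    (hS : ContDiffAt ℝ ∞ S u) (X : V) :
    ContDiffAt ℝ ∞ (fun y => PseudoEuclidean.covD Γ S y X) u := by
  have h1 := (ContDiffAt.fderiv_infty hS).clm_apply (contDiffAt_const (c := X))
  have h2 := hΓ.clm_apply (contDiffAt_const (c := X))
  exact (h1.add (h2.mul hS)).sub (hS.mul h2)

/-- The Ricci identity. -/
lemma covD_covD_sub {Γ : V → V →L[ℝ] 𝔸} {S : V → 𝔸} {u : V} (hΓ : ContDiffAt ℝ ∞ Γ u)
    (hS : ContDiffAt ℝ ∞ S u) (X Y : V) :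
    covD Γ (fun y => covD Γ S y Y) u X - covD Γ (fun y => covD Γ S y X) u Y
      = curvature Γ u X Y * S u - S u * curvature Γ u X Y := by
  have hS0 : DifferentiableAt ℝ S u := hS.differentiableAt (by simp)
  have hS1 : DifferentiableAt ℝ (fderiv ℝ S) u :=
    (ContDiffAt.fderiv_infty hS).differentiableAt (by simp)
  have hΓ0 : DifferentiableAt ℝ Γ u := hΓ.differentiableAt (by simp)
  have key : ∀ X Y, fderiv ℝ (fun y => covD Γ S y Y) u X
      = fderiv ℝ (fderiv ℝ S) u X Y + (fderiv ℝ Γ u X Y * S u + Γ u Y * fderiv ℝ S u X)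
        - (fderiv ℝ S u X * Γ u Y + S u * fderiv ℝ Γ u X Y) := fun X Y => by
    have d1 : DifferentiableAt ℝ (fun y => fderiv ℝ S y Y) u :=
      hS1.clm_apply (differentiableAt_const Y)
    have d2 : DifferentiableAt ℝ (fun y => Γ y Y) u := hΓ0.clm_apply (differentiableAt_const Y)
    simp only [covD]
    rw [fderiv_fun_sub (d1.fun_add (d2.fun_mul hS0)) (hS0.fun_mul d2),
      fderiv_fun_add d1 (d2.fun_mul hS0), fderiv_fun_mul' d2 hS0, fderiv_fun_mul' hS0 d2]
    simp only [_root_.sub_apply, _root_.add_apply, _root_.smul_apply, smul_eq_mul,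
      MulOpposite.smul_eq_mul_unop, MulOpposite.unop_op, fderiv_clm_apply_const hS1,
      fderiv_clm_apply_const hΓ0]
    abel
  have key' : ∀ X Y, covD Γ (fun y => covD Γ S y Y) u X
      = fderiv ℝ (fun y => covD Γ S y Y) u X + Γ u X * covD Γ S u Y - covD Γ S u Y * Γ u X :=
    fun _ _ => rfl
  rw [key', key', key, key, fderiv_fderiv_comm hS Y X]
  simp only [covD, curvature]
  noncomm_ring

end CovariantDerivative

end

noncomputable section

/-! ### Structure equations of a hypersurface, and the exclusion of constant imaginary principal
curvatures -/

section Frame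

variable {V W : Type*} [NormedAddCommGroup V] [NormedSpace ℝ V]
  [NormedAddCommGroup W] [NormedSpace ℝ W]

/-- `ξ` is a smooth unit normal field, of sign `ε`, along the nondegenerate hypersurface `f : U → W`
in the space `W` with scalar product `B`, and `π` the tangential projection along `ξ`. -/
structure IsAdaptedFrame (B : W →L[ℝ] W →L[ℝ] ℝ) (ε : ℝ) (U : Set V) (f ξ : V → W)
    (π : V → W →L[ℝ] V) : Prop where
  isOpen : IsOpen U
  symm : ∀ v w, B v w = B w v
  sq_eq_one : ε * ε = 1
  contDiffAt_map : ∀ u ∈ U, ContDiffAt ℝ ∞ f u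
  contDiffAt_normal : ∀ u ∈ U, ContDiffAt ℝ ∞ ξ u
  contDiffAt_proj : ∀ u ∈ U, ContDiffAt ℝ ∞ π u
  unit : ∀ u ∈ U, B (ξ u) (ξ u) = ε
  normal : ∀ u ∈ U, ∀ X, B (fderiv ℝ f u X) (ξ u) = 0
  proj_fderiv : ∀ u ∈ U, ∀ X, π u (fderiv ℝ f u X) = X
  decomp : ∀ u ∈ U, ∀ w, w = fderiv ℝ f u (π u w) + (ε * B w (ξ u)) • ξ u
  nondegenerate : ∀ u ∈ U, ∀ X, (∀ Y, B (fderiv ℝ f u X) (fderiv ℝ f u Y) = 0) → X = 0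

/-- The connection form `Γ_X Y` of the induced connection. -/
def connectionForm (f : V → W) (π : V → W →L[ℝ] V) (u : V) : V →L[ℝ] V →L[ℝ] V :=
  (ContinuousLinearMap.compL ℝ V W V (π u)).comp (fderiv ℝ (fderiv ℝ f) u)

/-- The shape operator `A X = - (d ξ X)ᵗᵃⁿ`. -/
def weingarten (ξ : V → W) (π : V → W →L[ℝ] V) (u : V) : V →L[ℝ] V :=
  -(π u).comp (fderiv ℝ ξ u)

lemma connectionForm_apply (f : V → W) (π : V → W →L[ℝ] V) (u X Y : V) :
    connectionForm f π u X Y = π u (fderiv ℝ (fderiv ℝ f) u X Y) := rfl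

lemma weingarten_apply (ξ : V → W) (π : V → W →L[ℝ] V) (u X : V) :
    weingarten ξ π u X = -π u (fderiv ℝ ξ u X) := rfl

namespace IsAdaptedFrame

variable {B : W →L[ℝ] W →L[ℝ] ℝ} {ε : ℝ} {U : Set V} {f ξ : V → W} {π : V → W →L[ℝ] V} {u : V}

local notation "Γ" => connectionForm f π
local notation "A" => weingarten ξ π

lemma proj_normal (h : IsAdaptedFrame B ε U f ξ π) (hu : u ∈ U) : π u (ξ u) = 0 := by
  refine h.nondegenerate u hu _ fun Y => ?_
  have h1 := h.decomp u hu (ξ u)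
  rw [h.unit u hu, h.sq_eq_one, one_smul, eq_comm, add_eq_right] at h1
  simp [h1]

lemma contDiffAt_fderiv (h : IsAdaptedFrame B ε U f ξ π) (hu : u ∈ U) :
    ContDiffAt ℝ ∞ (fderiv ℝ f) u :=
  ContDiffAt.fderiv_infty (h.contDiffAt_map u hu)

lemma contDiffAt_connectionForm (h : IsAdaptedFrame B ε U f ξ π) (hu : u ∈ U) :
    ContDiffAt ℝ ∞ Γ u :=
  (contDiffAt_const.clm_apply (h.contDiffAt_proj u hu)).clm_comp
    (ContDiffAt.fderiv_infty (h.contDiffAt_fderiv hu))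

lemma contDiffAt_weingarten (h : IsAdaptedFrame B ε U f ξ π) (hu : u ∈ U) :
    ContDiffAt ℝ ∞ A u :=
  ((h.contDiffAt_proj u hu).clm_comp
    (ContDiffAt.fderiv_infty (h.contDiffAt_normal u hu))).neg

lemma differentiableAt_fderiv (h : IsAdaptedFrame B ε U f ξ π) (hu : u ∈ U) :
    DifferentiableAt ℝ (fderiv ℝ f) u := (h.contDiffAt_fderiv hu).differentiableAt (by simp)

lemma differentiableAt_normal (h : IsAdaptedFrame B ε U f ξ π) (hu : u ∈ U) :
    DifferentiableAt ℝ ξ u := (h.contDiffAt_normal u hu).differentiableAt (by simp)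

lemma differentiableAt_connectionForm (h : IsAdaptedFrame B ε U f ξ π) (hu : u ∈ U) :
    DifferentiableAt ℝ Γ u := (h.contDiffAt_connectionForm hu).differentiableAt (by simp)

lemma differentiableAt_weingarten (h : IsAdaptedFrame B ε U f ξ π) (hu : u ∈ U) :
    DifferentiableAt ℝ A u := (h.contDiffAt_weingarten hu).differentiableAt (by simp)

lemma fderiv_bilin {v w : V → W} (hv : DifferentiableAt ℝ v u) (hw : DifferentiableAt ℝ w u)
    (X : V) : fderiv ℝ (fun y => B (v y) (w y)) u X
      = B (fderiv ℝ v u X) (w u) + B (v u) (fderiv ℝ w u X) := by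
  have hB : DifferentiableAt ℝ B (v u) := B.differentiableAt
  rw [fderiv_clm_apply_apply (c := fun y => B (v y)) (hB.comp u hv) hw]
  congr 2
  have := fderiv_comp u hB hv
  rw [show (fun y => B (v y)) = B ∘ v from rfl, this, B.fderiv]
  rfl

/-- The Weingarten formula. -/
lemma fderiv_normal (h : IsAdaptedFrame B ε U f ξ π) (hu : u ∈ U) (X : V) :
    fderiv ℝ ξ u X = -fderiv ℝ f u (A u X) := by
  have h1 : fderiv ℝ (fun y => B (ξ y) (ξ y)) u X = 0 := by
    rw [fderiv_congr_of_isOpen h.isOpen h.unit hu]; simp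
  rw [fderiv_bilin (h.differentiableAt_normal hu) (h.differentiableAt_normal hu),
    h.symm (ξ u)] at h1
  have h2 : B (fderiv ℝ ξ u X) (ξ u) = 0 := by linarith
  have h3 := h.decomp u hu (fderiv ℝ ξ u X)
  rw [h2] at h3
  rw [weingarten_apply, map_neg, neg_neg]
  simpa using h3

/-- Differentiate the orthogonality of `df Y` and `ξ` in the direction `X` and insert the Weingarten
formula. -/
lemma bilin_fderiv_fderiv_normal (h : IsAdaptedFrame B ε U f ξ π) (hu : u ∈ U) (X Y : V) :
    B (fderiv ℝ (fderiv ℝ f) u X Y) (ξ u) = B (fderiv ℝ f u (A u X)) (fderiv ℝ f u Y) := by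
  have h1 : fderiv ℝ (fun y => B (fderiv ℝ f y Y) (ξ y)) u X = 0 := by
    rw [fderiv_congr_of_isOpen h.isOpen (fun y hy => h.normal y hy Y) hu]; simp
  rw [fderiv_bilin ((h.differentiableAt_fderiv hu).clm_apply (differentiableAt_const Y))
    (h.differentiableAt_normal hu), fderiv_clm_apply_const (h.differentiableAt_fderiv hu),
    h.fderiv_normal hu, map_neg, h.symm (fderiv ℝ f u Y)] at h1
  linarith

/-- The Gauss formula. -/
lemma fderiv_fderiv (h : IsAdaptedFrame B ε U f ξ π) (hu : u ∈ U) (X Y : V) :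
    fderiv ℝ (fderiv ℝ f) u X Y = fderiv ℝ f u (Γ u X Y)
      + (ε * B (fderiv ℝ f u (A u X)) (fderiv ℝ f u Y)) • ξ u := by
  rw [← h.bilin_fderiv_fderiv_normal hu, connectionForm_apply]
  exact h.decomp u hu _

lemma connectionForm_comm (h : IsAdaptedFrame B ε U f ξ π) (hu : u ∈ U) (X Y : V) :
    Γ u X Y = Γ u Y X := by
  rw [connectionForm_apply, connectionForm_apply, fderiv_fderiv_comm (h.contDiffAt_map u hu)]

lemma bilin_weingarten (h : IsAdaptedFrame B ε U f ξ π) (hu : u ∈ U) (X Y : V) :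
    B (fderiv ℝ f u (A u X)) (fderiv ℝ f u Y) = B (fderiv ℝ f u X) (fderiv ℝ f u (A u Y)) := by
  rw [← h.bilin_fderiv_fderiv_normal hu, fderiv_fderiv_comm (h.contDiffAt_map u hu),
    h.bilin_fderiv_fderiv_normal hu, h.symm]

lemma fderiv_fderiv_apply (h : IsAdaptedFrame B ε U f ξ π) (hu : u ∈ U) {v : V → V}
    (hv : DifferentiableAt ℝ v u) (X : V) :
    fderiv ℝ (fun y => fderiv ℝ f y (v y)) u X
      = fderiv ℝ f u (Γ u X (v u) + fderiv ℝ v u X)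
        + (ε * B (fderiv ℝ f u (A u X)) (fderiv ℝ f u (v u))) • ξ u := by
  rw [fderiv_clm_apply_apply (h.differentiableAt_fderiv hu) hv, h.fderiv_fderiv hu, map_add]
  abel

lemma fderiv_fderiv_normal (h : IsAdaptedFrame B ε U f ξ π) (hu : u ∈ U) (X Y : V) :
    fderiv ℝ (fderiv ℝ ξ) u X Y = -(fderiv ℝ f u (Γ u X (A u Y) + fderiv ℝ A u X Y)
        + (ε * B (fderiv ℝ f u (A u X)) (fderiv ℝ f u (A u Y))) • ξ u) := by
  have h1 := (ContDiffAt.fderiv_infty (h.contDiffAt_normal u hu)).differentiableAt (by simp)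
  rw [← fderiv_clm_apply_const h1,
    fderiv_congr_of_isOpen h.isOpen (fun y hy => h.fderiv_normal hy Y) hu, fderiv_fun_neg,
    _root_.neg_apply,
    h.fderiv_fderiv_apply hu ((h.differentiableAt_weingarten hu).clm_apply
      (differentiableAt_const Y)), fderiv_clm_apply_const (h.differentiableAt_weingarten hu)]

/-- The Codazzi equation. -/
lemma codazzi (h : IsAdaptedFrame B ε U f ξ π) (hu : u ∈ U) (X Y : V) :
    covD Γ A u X Y = covD Γ A u Y X := by
  -- Codazzi is the tangential part of the symmetry of the second derivative of `ξ`, combined with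
  -- the vanishing of torsion.
  have h1 := congrArg (π u) (fderiv_fderiv_comm (h.contDiffAt_normal u hu) X Y)
  rw [h.fderiv_fderiv_normal hu, h.fderiv_fderiv_normal hu] at h1
  simp only [map_neg, map_add (π u), map_smul, h.proj_fderiv u hu, h.proj_normal hu, smul_zero,
    add_zero, neg_inj] at h1
  simp only [covD, _root_.add_apply, _root_.sub_apply, ContinuousLinearMap.mul_def,
    ContinuousLinearMap.comp_apply]
  rw [h.connectionForm_comm hu Y X]
  rw [add_comm (fderiv ℝ A u X Y), h1]
  abel

/-- The covariant derivative of the shape operator is self-adjoint. -/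
lemma bilin_covD_weingarten (h : IsAdaptedFrame B ε U f ξ π) (hu : u ∈ U) (Z X Y : V) :
    B (fderiv ℝ f u (covD Γ A u Z X)) (fderiv ℝ f u Y)
      = B (fderiv ℝ f u X) (fderiv ℝ f u (covD Γ A u Z Y)) := by
  have hd : ∀ X, DifferentiableAt ℝ (fun y => A y X) u := fun X =>
    (h.differentiableAt_weingarten hu).clm_apply (differentiableAt_const X)
  have hF : ∀ X, DifferentiableAt ℝ (fun y => fderiv ℝ f y X) u := fun X =>
    (h.differentiableAt_fderiv hu).clm_apply (differentiableAt_const X)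
  have hF' : ∀ X, DifferentiableAt ℝ (fun y => fderiv ℝ f y (A y X)) u := fun X =>
    (h.differentiableAt_fderiv hu).clm_apply (hd X)
  have h1 := congrArg (fun T : V →L[ℝ] ℝ => T Z)
    (fderiv_congr_of_isOpen h.isOpen (fun y hy => h.bilin_weingarten hy X Y) hu)
  have hn := h.normal u hu
  have hn' : ∀ X, B (ξ u) (fderiv ℝ f u X) = 0 := fun X => by rw [h.symm, hn]
  rw [fderiv_bilin (hF' X) (hF Y), fderiv_bilin (hF X) (hF' Y), h.fderiv_fderiv_apply hu (hd X),
    h.fderiv_fderiv_apply hu (hd Y), fderiv_clm_apply_const (h.differentiableAt_fderiv hu),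
    fderiv_clm_apply_const (h.differentiableAt_fderiv hu), h.fderiv_fderiv hu, h.fderiv_fderiv hu,
    fderiv_clm_apply_const (h.differentiableAt_weingarten hu),
    fderiv_clm_apply_const (h.differentiableAt_weingarten hu)] at h1
  have e1 := h.bilin_weingarten hu X (Γ u Z Y)
  have e2 := h.bilin_weingarten hu (Γ u Z X) Y
  simp only [map_add, map_smul, _root_.add_apply, _root_.smul_apply, hn, hn', smul_zero,
    add_zero] at h1
  simp only [covD, _root_.add_apply, _root_.sub_apply, ContinuousLinearMap.mul_def,
    ContinuousLinearMap.comp_apply, map_add, map_sub]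
  linarith

/-- The Gauss equation. -/
lemma gauss (h : IsAdaptedFrame B ε U f ξ π) (hu : u ∈ U) (X Y Z : V) :
    curvature Γ u X Y Z = ε • (B (fderiv ℝ f u (A u Y)) (fderiv ℝ f u Z) • A u X
      - B (fderiv ℝ f u (A u X)) (fderiv ℝ f u Z) • A u Y) := by
  have hF2 := (ContDiffAt.fderiv_infty (h.contDiffAt_fderiv hu)).differentiableAt (by simp)
  have hF3 : ∀ Y, DifferentiableAt ℝ (fun y => fderiv ℝ (fderiv ℝ f) y Y) u := fun Y =>
    hF2.clm_apply (differentiableAt_const Y)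
  -- The tangential part of the third derivative of `f`, from differentiating the Gauss formula.
  -- Symmetry in `X`, `Y` then gives the curvature.
  have key : ∀ X Y, π u (fderiv ℝ (fderiv ℝ (fderiv ℝ f)) u X Y Z)
      = Γ u X (Γ u Y Z) + fderiv ℝ Γ u X Y Z
        - (ε * B (fderiv ℝ f u (A u Y)) (fderiv ℝ f u Z)) • A u X := fun X Y => by
    have hΓ1 : DifferentiableAt ℝ (fun y => Γ y Y) u :=
      (h.differentiableAt_connectionForm hu).clm_apply (differentiableAt_const Y)
    have hΓ2 : DifferentiableAt ℝ (fun y => Γ y Y Z) u :=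
      hΓ1.clm_apply (differentiableAt_const Z)
    have hA : DifferentiableAt ℝ (fun y => A y Y) u :=
      (h.differentiableAt_weingarten hu).clm_apply (differentiableAt_const Y)
    have hF' : DifferentiableAt ℝ (fun y => fderiv ℝ f y (A y Y)) u :=
      (h.differentiableAt_fderiv hu).clm_apply hA
    have hF : DifferentiableAt ℝ (fun y => fderiv ℝ f y Z) u :=
      (h.differentiableAt_fderiv hu).clm_apply (differentiableAt_const Z)
    have hs : DifferentiableAt ℝ
        (fun y => ε * B (fderiv ℝ f y (A y Y)) (fderiv ℝ f y Z)) u :=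
      ((B.differentiableAt.comp u hF').clm_apply hF).const_mul ε
    rw [← fderiv_clm_apply_const hF2, ← fderiv_clm_apply_const (hF3 Y),
      fderiv_congr_of_isOpen h.isOpen (fun y hy => h.fderiv_fderiv hy Y Z) hu,
      fderiv_fun_add ((h.differentiableAt_fderiv hu).clm_apply hΓ2)
        (hs.fun_smul (h.differentiableAt_normal hu)),
      fderiv_fun_smul hs (h.differentiableAt_normal hu)]
    simp only [_root_.add_apply, _root_.smul_apply, ContinuousLinearMap.smulRight_apply, map_add]
    rw [h.fderiv_fderiv_apply hu hΓ2, h.fderiv_normal hu]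
    simp only [map_add (π u), map_smul, map_neg, h.proj_fderiv u hu, h.proj_normal hu, smul_zero,
      add_zero]
    rw [fderiv_clm_apply_const hΓ1, fderiv_clm_apply_const (h.differentiableAt_connectionForm hu)]
    module
  have h1 := key X Y
  rw [fderiv_fderiv_comm (h.contDiffAt_fderiv hu) X Y, key Y X] at h1
  simp only [curvature, _root_.add_apply, _root_.sub_apply, ContinuousLinearMap.mul_def,
    ContinuousLinearMap.comp_apply]
  rw [smul_sub, smul_smul, smul_smul, ← sub_eq_zero]
  rw [← sub_eq_zero] at h1
  rw [← neg_eq_zero, ← h1]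
  abel

set_option maxHeartbeats 2000000 in
/-- A nondegenerate hypersurface of dimension four cannot have constant principal curvatures
`a ± i b`, both imaginary. -/
theorem false_of_constant_imaginary (h : IsAdaptedFrame B ε U f ξ π)
    (hV : Module.finrank ℝ V = 4) (hne : U.Nonempty) {a b : ℝ} (hb : b ≠ 0)
    (hA : ∀ u ∈ U, ((A u - a • 1) * (A u - a • 1) + b ^ 2 • 1)
      * ((A u - a • 1) * (A u - a • 1) + b ^ 2 • 1) = 0) : False := by
  set P : V → V →L[ℝ] V := fun u => A u + (-a) • 1 with hP
  set Q : V → V →L[ℝ] V := fun u => P u * P u + b ^ 2 • 1 with hQ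
  have hAP : ∀ u, A u = P u + a • 1 := fun u => by simp [hP]
  have hQQ : ∀ u ∈ U, Q u * Q u = 0 := fun u hu => by
    have := hA u hu
    simpa [hQ, hP, sub_eq_add_neg] using this
  have hQQ' : ∀ u ∈ U, ∀ v, Q u (Q u v) = 0 := fun u hu v => by
    simpa using DFunLike.congr_fun (hQQ u hu) v
  have cP : ∀ u ∈ U, ContDiffAt ℝ ∞ P u := fun u hu =>
    (h.contDiffAt_weingarten hu).add contDiffAt_const
  have cQ : ∀ u ∈ U, ContDiffAt ℝ ∞ Q u := fun u hu =>
    ((cP u hu).mul (cP u hu)).add contDiffAt_const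
  have dP : ∀ u ∈ U, DifferentiableAt ℝ P u := fun u hu => (cP u hu).differentiableAt (by simp)
  have dQ : ∀ u ∈ U, DifferentiableAt ℝ Q u := fun u hu => (cQ u hu).differentiableAt (by simp)
  have covP : ∀ u X, covD Γ P u X = covD Γ A u X := fun u X => covD_add_smul_one _ _ _
  have covQ : ∀ u ∈ U, ∀ X, covD Γ Q u X = P u * covD Γ A u X + covD Γ A u X * P u :=
    fun u hu X => by
      have e : covD Γ Q u X = covD Γ (fun y => P y * P y) u X :=
        covD_add_smul_one Γ (S := fun y => P y * P y) (b ^ 2) X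
      rw [e, covD_mul _ (dP u hu) (dP u hu), covP, add_comm]
  set g : V → V →L[ℝ] V →L[ℝ] ℝ := fun u => B.bilinearComp (fderiv ℝ f u) (fderiv ℝ f u) with hg
  have g_apply : ∀ u X Y, g u X Y = B (fderiv ℝ f u X) (fderiv ℝ f u Y) := fun u X Y => rfl
  have g_nd : ∀ u ∈ U, ∀ X, (∀ Y, g u X Y = 0) → X = 0 := fun u hu => h.nondegenerate u hu
  have g_symm : ∀ u X Y, g u X Y = g u Y X := fun u X Y => h.symm _ _
  have g_A : ∀ u ∈ U, ∀ X Y, g u (A u X) Y = g u X (A u Y) := fun u hu => h.bilin_weingarten hu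
  have g_P : ∀ u ∈ U, ∀ X Y, g u (P u X) Y = g u X (P u Y) := fun u hu X Y => by
    simp [hP, g_A u hu]
  have hε : ε ≠ 0 := fun h0 => by simpa [h0] using h.sq_eq_one
  have hgauss : ∀ u ∈ U, ∀ X Y Z, curvature Γ u X Y Z
      = ε • (g u (A u Y) Z • A u X - g u (A u X) Z • A u Y) := fun u hu => h.gauss hu
  -- The algebraic lemma applies with `C = ∇A`: Codazzi and self-adjointness give total symmetry,
  -- and `∇(Q²) = 0` gives the remaining hypothesis.
  have hK : ∀ u ∈ U, ∀ X, covD Γ Q u X * Q u = 0 := fun u hu X => by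
    rw [covQ u hu]
    refine anticommutator_mul_eq_zero hV hb rfl (hQQ u hu) (g_nd u hu) (g_P u hu)
      (h.codazzi hu) (h.bilin_covD_weingarten hu) (g_symm u) (fun X => ?_) X
    rw [← covQ u hu, add_comm, ← covD_mul _ (dQ u hu) (dQ u hu),
      covD_congr _ h.isOpen hQQ hu, covD_zero]
  have hK' : ∀ u ∈ U, ∀ X, Q u * covD Γ Q u X = 0 := fun u hu X => by
    have := covD_mul Γ (dQ u hu) (dQ u hu) X
    rwa [covD_congr _ h.isOpen hQQ hu, covD_zero, hK u hu, zero_add, eq_comm] at this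
  have hQ0 : ∀ u ∈ U, Q u = 0 := fun u hu => by
    by_contra hne0
    obtain ⟨w, hw⟩ : ∃ w, Q u w ≠ 0 := by
      by_contra! hcon
      exact hne0 (ContinuousLinearMap.ext hcon)
    -- Since `Q ∇Q = 0`, the image of `∇Q` lies in `ker Q = im Q`, which `∇Q` annihilates by `hK`.
    have hKK : ∀ X Y, covD Γ Q u X * covD Γ Q u Y = 0 := fun X Y => by
      ext Z
      have h1 : Q u (covD Γ Q u Y Z) = 0 := by simpa using DFunLike.congr_fun (hK' u hu Y) Z
      obtain ⟨t, ht⟩ := exists_eq_apply_of_apply_eq_zero hV hb rfl (hQQ' u hu) hw h1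
      change covD Γ Q u X (covD Γ Q u Y Z) = 0
      rw [ht]
      exact DFunLike.congr_fun (hK u hu X) t
    have hdK : ∀ X Y, covD Γ (fun y => covD Γ Q y X) u Y * Q u = 0 := fun X Y => by
      have hd := (ContDiffAt.covD (h.contDiffAt_connectionForm hu) (cQ u hu) X).differentiableAt
        (by simp)
      have := covD_mul Γ hd (dQ u hu) Y
      rwa [covD_congr _ h.isOpen (fun y hy => hK y hy X) hu, covD_zero, hKK, add_zero,
        eq_comm] at this
    -- Multiply the Ricci identity for `Q` by `Q` on the right: second derivatives vanish by `hdK`,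
    -- and `R Q Q` vanishes since `Q² = 0`.
    have hR : ∀ X Y, Q u * curvature Γ u X Y * Q u = 0 := fun X Y => by
      have := congrArg (· * Q u)
        (covD_covD_sub (h.contDiffAt_connectionForm hu) (cQ u hu) X Y)
      simp only [sub_mul, hdK, mul_assoc, hQQ u hu, mul_zero, sub_zero, zero_sub] at this
      rw [mul_assoc]
      exact neg_eq_zero.mp this.symm
    refine hne0 (eq_zero_of_curvature_image hV (hAP u) hb rfl (hQQ' u hu) (g_nd u hu) (g_A u hu)
      (g_symm u) fun X Y Z => ?_)
    have := DFunLike.congr_fun (hR X Y) Z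
    simp only [ContinuousLinearMap.mul_def, ContinuousLinearMap.comp_apply, hgauss u hu] at this
    rw [map_smul] at this
    exact (smul_eq_zero.mp this).resolve_left hε
  have hC : ∀ u ∈ U, ∀ X, covD Γ A u X = 0 := fun u hu X => by
    refine eq_zero_of_anticommute hb (hQ0 u hu) (g_nd u hu) (g_P u hu) (g_symm u)
      (h.codazzi hu) (h.bilin_covD_weingarten hu) (fun X => ?_) X
    rw [← covQ u hu, covD_congr _ h.isOpen hQ0 hu, covD_zero]
  obtain ⟨u, hu⟩ := hne
  refine false_of_curvature_commute hV (hAP u) hb (hQ0 u hu) (g_nd u hu) fun X Y Z => ?_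
  have h1 := covD_covD_sub (h.contDiffAt_connectionForm hu) (h.contDiffAt_weingarten hu) X Y
  rw [covD_congr _ h.isOpen (fun y hy => hC y hy Y) hu,
    covD_congr _ h.isOpen (fun y hy => hC y hy X) hu, covD_zero, covD_zero, sub_zero, eq_comm,
    sub_eq_zero] at h1
  have h2 := DFunLike.congr_fun h1 Z
  simp only [ContinuousLinearMap.mul_def, ContinuousLinearMap.comp_apply, hgauss u hu] at h2
  rw [map_smul] at h2
  exact smul_right_injective V hε h2

end IsAdaptedFrame

end Frame

end

noncomputable section

/-! ### From coordinate formulas to invariant ones -/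

section Coordinates

variable {n m : ℕ}

/-- The scalar product of index `s` as a continuous bilinear form. -/
def scalarProductCLM (m s : ℕ) :
    EuclideanSpace ℝ (Fin m) →L[ℝ] EuclideanSpace ℝ (Fin m) →L[ℝ] ℝ :=
  ∑ i : Fin m, (if (i : ℕ) < s then (-1 : ℝ) else 1) •
    (EuclideanSpace.proj i : EuclideanSpace ℝ (Fin m) →L[ℝ] ℝ).smulRight
      (EuclideanSpace.proj i : EuclideanSpace ℝ (Fin m) →L[ℝ] ℝ)

lemma scalarProductCLM_apply (s : ℕ) (v w : EuclideanSpace ℝ (Fin m)) :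
    scalarProductCLM m s v w = scalarProduct s v w := by
  simp only [scalarProductCLM, scalarProduct, _root_.sum_apply, _root_.smul_apply,
    ContinuousLinearMap.smulRight_apply, PiLp.proj_apply, smul_eq_mul]

lemma scalarProductCLM_comm (s : ℕ) (v w : EuclideanSpace ℝ (Fin m)) :
    scalarProductCLM m s v w = scalarProductCLM m s w v := by
  simp only [scalarProductCLM_apply, scalarProduct, mul_comm]

lemma eq_zero_of_scalarProductCLM_eq_zero {s : ℕ} {v : EuclideanSpace ℝ (Fin m)}
    (h : ∀ w, scalarProductCLM m s v w = 0) : v = 0 := by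
  ext i
  have := h (EuclideanSpace.single i 1)
  simp only [scalarProductCLM_apply, scalarProduct, PiLp.single_apply, mul_ite, mul_one,
    mul_zero, Finset.sum_ite_eq', Finset.mem_univ, if_true] at this
  split_ifs at this <;> simpa using this

lemma sum_smul_single (x : EuclideanSpace ℝ (Fin n)) :
    ∑ i, x i • EuclideanSpace.single i (1 : ℝ) = x := by
  ext j
  simp [Pi.single_apply]

variable {s : ℕ} {f : EuclideanSpace ℝ (Fin n) → EuclideanSpace ℝ (Fin m)}
  {u : EuclideanSpace ℝ (Fin n)}

lemma metric_apply (i j : Fin n) : metric s f u i j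
    = scalarProductCLM m s (fderiv ℝ f u (EuclideanSpace.single i 1))
        (fderiv ℝ f u (EuclideanSpace.single j 1)) := by
  simp [metric, pd, scalarProductCLM_apply]

lemma metric_comm (i j : Fin n) : metric s f u i j = metric s f u j i := by
  rw [metric_apply, metric_apply, scalarProductCLM_comm]

lemma metric_transpose : (metric s f u).transpose = metric s f u := by
  ext i j; exact metric_comm j i

lemma metric_inv_comm (i j : Fin n) : (metric s f u)⁻¹ i j = (metric s f u)⁻¹ j i := by
  have := Matrix.transpose_nonsing_inv (metric s f u)
  rw [metric_transpose] at this
  exact congrFun (congrFun this.symm i) j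

lemma contDiffAt_metric (hf : ContDiffAt ℝ ∞ f u) (i j : Fin n) :
    ContDiffAt ℝ ∞ (fun v => metric s f v i j) u := by
  simp only [metric_apply]
  have hF := ContDiffAt.fderiv_infty hf
  exact (contDiffAt_const.clm_apply (hF.clm_apply contDiffAt_const)).clm_apply
    (hF.clm_apply contDiffAt_const)

lemma contDiffAt_det {V : Type*} [NormedAddCommGroup V] [NormedSpace ℝ V] {u : V}
    {M : V → Matrix (Fin n) (Fin n) ℝ} (hM : ∀ i j, ContDiffAt ℝ ∞ (fun v => M v i j) u) :
    ContDiffAt ℝ ∞ (fun v => (M v).det) u := by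
  simp only [Matrix.det_apply]
  refine ContDiffAt.sum fun σ _ => ?_
  exact (contDiffAt_prod fun i _ => hM _ _).const_smul (Equiv.Perm.sign σ)

lemma contDiffAt_matrix_inv {V : Type*} [NormedAddCommGroup V] [NormedSpace ℝ V] {u : V}
    {M : V → Matrix (Fin n) (Fin n) ℝ} (hM : ∀ i j, ContDiffAt ℝ ∞ (fun v => M v i j) u)
    (hdet : (M u).det ≠ 0) (i j : Fin n) : ContDiffAt ℝ ∞ (fun v => (M v)⁻¹ i j) u := by
  simp only [Matrix.inv_def, Ring.inverse_eq_inv', Matrix.smul_apply, smul_eq_mul]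
  refine ((contDiffAt_det hM).inv hdet).mul ?_
  simp only [Matrix.adjugate_apply]
  refine contDiffAt_det fun k l => ?_
  simp only [Matrix.updateRow_apply]
  split_ifs
  · exact contDiffAt_const
  · exact hM k l

lemma eq_zero_of_metric_nondegenerate (hdet : (metric s f u).det ≠ 0)
    {X : EuclideanSpace ℝ (Fin n)}
    (hX : ∀ Y, scalarProductCLM m s (fderiv ℝ f u X) (fderiv ℝ f u Y) = 0) : X = 0 := by
  have h : Matrix.vecMul (fun i => X i) (metric s f u) = 0 := by
    ext j
    have := hX (EuclideanSpace.single j 1)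
    rw [← sum_smul_single X] at this
    simpa [Matrix.vecMul, dotProduct, metric_apply, _root_.sum_apply] using this
  ext i
  exact congrFun (Matrix.eq_zero_of_vecMul_eq_zero hdet h) i

variable (s f u) in
/-- The orthogonal projection onto the tangent space, in coordinates. -/
def tangentialProj : EuclideanSpace ℝ (Fin m) →L[ℝ] EuclideanSpace ℝ (Fin n) :=
  ∑ k : Fin n, ∑ l : Fin n, (metric s f u)⁻¹ k l •
    (scalarProductCLM m s (fderiv ℝ f u (EuclideanSpace.single l 1))).smulRight
      (EuclideanSpace.single k (1 : ℝ))

lemma tangentialProj_apply (w : EuclideanSpace ℝ (Fin m)) (k : Fin n) :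
    tangentialProj s f u w k = ∑ l, (metric s f u)⁻¹ k l *
      scalarProductCLM m s (fderiv ℝ f u (EuclideanSpace.single l 1)) w := by
  simp only [tangentialProj, _root_.sum_apply, _root_.smul_apply,
    ContinuousLinearMap.smulRight_apply, WithLp.ofLp_sum, WithLp.ofLp_smul, Finset.sum_apply,
    Pi.smul_apply, PiLp.single_apply, smul_eq_mul]
  rw [Finset.sum_comm]
  simp

lemma contDiffAt_tangentialProj (hf : ContDiffAt ℝ ∞ f u) (hdet : (metric s f u).det ≠ 0) :
    ContDiffAt ℝ ∞ (tangentialProj s f) u := by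
  have hF := ContDiffAt.fderiv_infty hf
  refine ContDiffAt.sum fun k _ => ContDiffAt.sum fun l _ => ?_
  refine (contDiffAt_matrix_inv (contDiffAt_metric hf) hdet k l).smul ?_
  exact (contDiffAt_const.clm_apply (hF.clm_apply contDiffAt_const)).smulRight contDiffAt_const

lemma scalarProductCLM_tangentialProj (hdet : (metric s f u).det ≠ 0)
    (w : EuclideanSpace ℝ (Fin m)) (Y : EuclideanSpace ℝ (Fin n)) :
    scalarProductCLM m s (fderiv ℝ f u (tangentialProj s f u w)) (fderiv ℝ f u Y)
      = scalarProductCLM m s w (fderiv ℝ f u Y) := by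
  have h : ∀ j, scalarProductCLM m s (fderiv ℝ f u (tangentialProj s f u w))
      (fderiv ℝ f u (EuclideanSpace.single j 1))
      = scalarProductCLM m s w (fderiv ℝ f u (EuclideanSpace.single j 1)) := fun j => by
    rw [← sum_smul_single (tangentialProj s f u w)]
    simp only [map_sum, map_smul, _root_.sum_apply, _root_.smul_apply, smul_eq_mul,
      ← metric_apply, tangentialProj_apply, Finset.sum_mul]
    rw [Finset.sum_comm]
    have e : ∀ l, ∑ k, (metric s f u)⁻¹ k l *
        scalarProductCLM m s (fderiv ℝ f u (EuclideanSpace.single l 1)) w * metric s f u k j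
        = (1 : Matrix (Fin n) (Fin n) ℝ) l j *
          scalarProductCLM m s (fderiv ℝ f u (EuclideanSpace.single l 1)) w := fun l => by
      rw [← Matrix.nonsing_inv_mul (metric s f u) (isUnit_iff_ne_zero.mpr hdet), Matrix.mul_apply,
        Finset.sum_mul]
      refine Finset.sum_congr rfl fun k _ => ?_
      rw [metric_inv_comm k l]; ring
    simp only [e, Matrix.one_apply, ite_mul, one_mul, zero_mul, Finset.sum_ite_eq',
      Finset.mem_univ, if_true]
    exact scalarProductCLM_comm _ _ _
  rw [← sum_smul_single Y]
  simp only [map_sum, map_smul, h]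

lemma tangentialProj_fderiv (hdet : (metric s f u).det ≠ 0) (X : EuclideanSpace ℝ (Fin n)) :
    tangentialProj s f u (fderiv ℝ f u X) = X := by
  rw [← sub_eq_zero]
  refine eq_zero_of_metric_nondegenerate hdet fun Y => ?_
  rw [map_sub, map_sub, _root_.sub_apply, scalarProductCLM_tangentialProj hdet, sub_self]

lemma tangentialProj_eq_zero (hdet : (metric s f u).det ≠ 0) {η : EuclideanSpace ℝ (Fin m)}
    (hη : ∀ X, scalarProductCLM m s (fderiv ℝ f u X) η = 0) : tangentialProj s f u η = 0 := by
  refine eq_zero_of_metric_nondegenerate hdet fun Y => ?_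
  rw [scalarProductCLM_tangentialProj hdet, scalarProductCLM_comm, hη]

/-- Each derivative of the metric is a sum of two products of a second with a first derivative of
`f`. In the Koszul combination all cancel except twice `⟨∂ᵢ∂ⱼf, ∂ₗf⟩`, so the intrinsic connection
is the tangential part of the flat one. -/
lemma christoffel_eq (hf : ContDiffAt ℝ ∞ f u) (k i j : Fin n) :
    christoffel s f u k i j = connectionForm f (tangentialProj s f) u
      (EuclideanSpace.single i 1) (EuclideanSpace.single j 1) k := by
  have hF : ∀ X, DifferentiableAt ℝ (fun v => fderiv ℝ f v X) u := fun X =>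
    ((ContDiffAt.fderiv_infty hf).differentiableAt (by simp)).clm_apply (differentiableAt_const X)
  have hF1 := (ContDiffAt.fderiv_infty hf).differentiableAt (by simp)
  have hpd : ∀ i j l : Fin n, pd i (fun v => metric s f v j l) u
      = scalarProductCLM m s (fderiv ℝ (fderiv ℝ f) u (EuclideanSpace.single i 1)
          (EuclideanSpace.single j 1)) (fderiv ℝ f u (EuclideanSpace.single l 1))
        + scalarProductCLM m s (fderiv ℝ f u (EuclideanSpace.single j 1))
          (fderiv ℝ (fderiv ℝ f) u (EuclideanSpace.single i 1) (EuclideanSpace.single l 1)) :=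
    fun i j l => by
      simp only [pd, metric_apply]
      rw [IsAdaptedFrame.fderiv_bilin (hF _) (hF _), fderiv_clm_apply_const hF1,
        fderiv_clm_apply_const hF1]
  rw [connectionForm_apply, tangentialProj_apply, christoffel, Finset.mul_sum]
  refine Finset.sum_congr rfl fun l _ => ?_
  rw [hpd, hpd, hpd, fderiv_fderiv_comm hf (EuclideanSpace.single j 1) (EuclideanSpace.single i 1),
    fderiv_fderiv_comm hf (EuclideanSpace.single l 1) (EuclideanSpace.single i 1),
    fderiv_fderiv_comm hf (EuclideanSpace.single l 1) (EuclideanSpace.single j 1),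
    scalarProductCLM_comm s _ (fderiv ℝ f u (EuclideanSpace.single l 1)),
    scalarProductCLM_comm s _ (fderiv ℝ f u (EuclideanSpace.single j 1))]
  ring

lemma hessian_eq {F : Type*} [NormedAddCommGroup F] [NormedSpace ℝ F]
    {φ : EuclideanSpace ℝ (Fin n) → F} (hf : ContDiffAt ℝ ∞ f u)
    (hφ : DifferentiableAt ℝ (fderiv ℝ φ) u) (i j : Fin n) :
    hessian s f φ u i j
      = fderiv ℝ (fderiv ℝ φ) u (EuclideanSpace.single i 1) (EuclideanSpace.single j 1)
        - fderiv ℝ φ u (connectionForm f (tangentialProj s f) u (EuclideanSpace.single i 1)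
          (EuclideanSpace.single j 1)) := by
  have h1 : pd i (pd j φ) u
      = fderiv ℝ (fderiv ℝ φ) u (EuclideanSpace.single i 1) (EuclideanSpace.single j 1) :=
    fderiv_clm_apply_const hφ _ _
  rw [hessian, h1]
  congr 1
  conv_rhs => rw [← sum_smul_single (connectionForm f (tangentialProj s f) u _ _)]
  simp only [map_sum, map_smul, christoffel_eq hf, pd]

lemma scalarProductCLM_secondFundamentalForm (hf : ContDiffAt ℝ ∞ f u)
    (hdet : (metric s f u).det ≠ 0) (i j : Fin n) (X : EuclideanSpace ℝ (Fin n)) :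
    scalarProductCLM m s (fderiv ℝ f u X) (secondFundamentalForm s f u i j) = 0 := by
  rw [secondFundamentalForm,
    hessian_eq hf ((ContDiffAt.fderiv_infty hf).differentiableAt (by simp)), map_sub,
    scalarProductCLM_comm, scalarProductCLM_comm s _ (fderiv ℝ f u (connectionForm _ _ _ _ _)),
    connectionForm_apply, scalarProductCLM_tangentialProj hdet, sub_self]

lemma contDiffAt_secondFundamentalForm {U : Set (EuclideanSpace ℝ (Fin n))} (hU : IsOpen U)
    (hf : ∀ u ∈ U, ContDiffAt ℝ ∞ f u) (hdet : ∀ u ∈ U, (metric s f u).det ≠ 0) (hu : u ∈ U)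
    (i j : Fin n) : ContDiffAt ℝ ∞ (fun v => secondFundamentalForm s f v i j) u := by
  have hF := ContDiffAt.fderiv_infty (hf u hu)
  have hFF := ContDiffAt.fderiv_infty hF
  have h1 : ContDiffAt ℝ ∞ (fun v =>
      fderiv ℝ (fderiv ℝ f) v (EuclideanSpace.single i 1) (EuclideanSpace.single j 1)
        - fderiv ℝ f v (tangentialProj s f v
          (fderiv ℝ (fderiv ℝ f) v (EuclideanSpace.single i 1) (EuclideanSpace.single j 1)))) u := by
    have h2 := (hFF.clm_apply (contDiffAt_const (c := EuclideanSpace.single i (1 : ℝ)))).clm_apply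
      (contDiffAt_const (c := EuclideanSpace.single j (1 : ℝ)))
    exact h2.sub (hF.clm_apply ((contDiffAt_tangentialProj (hf u hu) (hdet u hu)).clm_apply h2))
  refine h1.congr_of_eventuallyEq (Filter.eventually_of_mem (hU.mem_nhds hu) fun v hv => ?_)
  exact hessian_eq (hf v hv) ((ContDiffAt.fderiv_infty (hf v hv)).differentiableAt (by simp)) i j

lemma contDiffAt_meanCurvatureVector {U : Set (EuclideanSpace ℝ (Fin n))} (hU : IsOpen U)
    (hf : ∀ u ∈ U, ContDiffAt ℝ ∞ f u) (hdet : ∀ u ∈ U, (metric s f u).det ≠ 0) (hu : u ∈ U) :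
    ContDiffAt ℝ ∞ (meanCurvatureVector s f) u :=
  (ContDiffAt.sum fun i _ => ContDiffAt.sum fun j _ =>
    (contDiffAt_matrix_inv (contDiffAt_metric (hf u hu)) (hdet u hu) i j).smul
      (contDiffAt_secondFundamentalForm hU hf hdet hu i j)).const_smul _

lemma scalarProductCLM_meanCurvatureVector (hf : ContDiffAt ℝ ∞ f u)
    (hdet : (metric s f u).det ≠ 0) (X : EuclideanSpace ℝ (Fin n)) :
    scalarProductCLM m s (fderiv ℝ f u X) (meanCurvatureVector s f u) = 0 := by
  simp [meanCurvatureVector, scalarProductCLM_secondFundamentalForm hf hdet]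

end Coordinates

/-! ### Codimension one: normal vectors and adapted frames -/

section Hypersurface

variable {n s : ℕ} {f : EuclideanSpace ℝ (Fin n) → EuclideanSpace ℝ (Fin (n + 1))}
  {u : EuclideanSpace ℝ (Fin n)}

lemma exists_eq_fderiv_add_smul (hdet : (metric s f u).det ≠ 0)
    {η : EuclideanSpace ℝ (Fin (n + 1))} (hη0 : η ≠ 0)
    (hη : ∀ X, scalarProductCLM (n + 1) s (fderiv ℝ f u X) η = 0)
    (w : EuclideanSpace ℝ (Fin (n + 1))) : ∃ X, ∃ t : ℝ, w = fderiv ℝ f u X + t • η := by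
  set Φ : EuclideanSpace ℝ (Fin n) × ℝ →ₗ[ℝ] EuclideanSpace ℝ (Fin (n + 1)) :=
    (fderiv ℝ f u).toLinearMap.coprod (LinearMap.toSpanSingleton ℝ _ η) with hΦ
  have hinj : Function.Injective Φ := by
    rw [injective_iff_map_eq_zero]
    rintro ⟨X, t⟩ h
    have h' : fderiv ℝ f u X + t • η = 0 := by simpa [hΦ] using h
    have h1 := congrArg (tangentialProj s f u) h'
    rw [map_add, map_smul, tangentialProj_fderiv hdet, tangentialProj_eq_zero hdet hη] at h1
    have hX : X = 0 := by simpa using h1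
    subst hX
    have : t = 0 := by simpa [hη0] using h'
    simp [this]
  have hsurj : Function.Surjective Φ :=
    (LinearMap.injective_iff_surjective_of_finrank_eq_finrank (by simp)).mp hinj
  obtain ⟨⟨X, t⟩, rfl⟩ := hsurj w
  exact ⟨X, t, by simp [hΦ]⟩

/-- A null normal vector would be orthogonal to the tangent space and to itself, hence to the whole
ambient space. This allows the mean curvature vector to be normalized where it does not vanish. -/
lemma scalarProductCLM_self_ne_zero (hdet : (metric s f u).det ≠ 0)
    {η : EuclideanSpace ℝ (Fin (n + 1))} (hη0 : η ≠ 0)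
    (hη : ∀ X, scalarProductCLM (n + 1) s (fderiv ℝ f u X) η = 0) :
    scalarProductCLM (n + 1) s η η ≠ 0 := fun h => by
  refine hη0 (eq_zero_of_scalarProductCLM_eq_zero (s := s) fun w => ?_)
  obtain ⟨X, t, rfl⟩ := exists_eq_fderiv_add_smul hdet hη0 hη w
  rw [map_add, map_smul, scalarProductCLM_comm, hη, h]
  simp

lemma isAdaptedFrame_tangentialProj {U : Set (EuclideanSpace ℝ (Fin n))} (hU : IsOpen U)
    (hf : ∀ u ∈ U, ContDiffAt ℝ ∞ f u) (hdet : ∀ u ∈ U, (metric s f u).det ≠ 0) {ε : ℝ}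
    (hε : ε * ε = 1) {ξ : EuclideanSpace ℝ (Fin n) → EuclideanSpace ℝ (Fin (n + 1))}
    (hξ : ∀ u ∈ U, ContDiffAt ℝ ∞ ξ u)
    (hunit : ∀ u ∈ U, scalarProductCLM (n + 1) s (ξ u) (ξ u) = ε)
    (hn : ∀ u ∈ U, ∀ X, scalarProductCLM (n + 1) s (fderiv ℝ f u X) (ξ u) = 0) :
    IsAdaptedFrame (scalarProductCLM (n + 1) s) ε U f ξ (tangentialProj s f) where
  isOpen := hU
  symm := scalarProductCLM_comm s
  sq_eq_one := hε
  contDiffAt_map := hf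
  contDiffAt_normal := hξ
  contDiffAt_proj u hu := contDiffAt_tangentialProj (hf u hu) (hdet u hu)
  unit := hunit
  normal := hn
  proj_fderiv u hu := tangentialProj_fderiv (hdet u hu)
  decomp u hu w := by
    have hξ0 : ξ u ≠ 0 := fun h0 => by
      have := hunit u hu
      rw [h0] at this
      simp only [map_zero] at this
      rw [← this] at hε
      simp at hε
    obtain ⟨X, t, rfl⟩ := exists_eq_fderiv_add_smul (hdet u hu) hξ0 (hn u hu) w
    have h1 : tangentialProj s f u (fderiv ℝ f u X + t • ξ u) = X := by
      rw [map_add, map_smul, tangentialProj_fderiv (hdet u hu),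
        tangentialProj_eq_zero (hdet u hu) (hn u hu), smul_zero, add_zero]
    have h2 : ε * scalarProductCLM (n + 1) s (fderiv ℝ f u X + t • ξ u) (ξ u) = t := by
      rw [map_add, map_smul, _root_.add_apply, hn u hu, _root_.smul_apply, hunit u hu, smul_eq_mul]
      linear_combination t * hε
    rw [h1, h2]
  nondegenerate u hu _ hX := eq_zero_of_metric_nondegenerate (hdet u hu) hX

end Hypersurface

end

noncomputable section

/-! ### Matrices and traces of endomorphisms -/

section MatrixRep

variable {n : ℕ}

/-- The matrix of an endomorphism of `ℝⁿ` in the standard basis. -/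
def matrixRep (n : ℕ) : (EuclideanSpace ℝ (Fin n) →L[ℝ] EuclideanSpace ℝ (Fin n)) →ₐ[ℝ]
    Matrix (Fin n) (Fin n) ℝ where
  toRingHom := (LinearMap.toMatrixAlgEquiv
    (EuclideanSpace.basisFun (Fin n) ℝ).toBasis).toRingEquiv.toRingHom.comp
      ContinuousLinearMap.toLinearMapRingHom
  commutes' c := (LinearMap.toMatrixAlgEquiv
    (EuclideanSpace.basisFun (Fin n) ℝ).toBasis).commutes c

lemma matrixRep_apply (T : EuclideanSpace ℝ (Fin n) →L[ℝ] EuclideanSpace ℝ (Fin n))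
    (i j : Fin n) : matrixRep n T i j = T (EuclideanSpace.single j 1) i := by
  change LinearMap.toMatrixAlgEquiv (EuclideanSpace.basisFun (Fin n) ℝ).toBasis T.toLinearMap i j = _
  simp [LinearMap.toMatrixAlgEquiv_apply]

lemma matrixRep_injective : Function.Injective (matrixRep n) := fun S T h => by
  refine ContinuousLinearMap.ext fun x => ?_
  rw [← sum_smul_single x, map_sum, map_sum]
  refine Finset.sum_congr rfl fun j _ => ?_
  rw [map_smul, map_smul]
  congr 1
  ext i
  rw [← matrixRep_apply, ← matrixRep_apply, h]

lemma trace_matrixRep (T : EuclideanSpace ℝ (Fin n) →L[ℝ] EuclideanSpace ℝ (Fin n)) :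
    (matrixRep n T).trace = ∑ i, T (EuclideanSpace.single i 1) i := by
  simp [Matrix.trace, matrixRep_apply]

/-- The trace as a continuous linear form. -/
def traceCLM (n : ℕ) : (EuclideanSpace ℝ (Fin n) →L[ℝ] EuclideanSpace ℝ (Fin n)) →L[ℝ] ℝ :=
  LinearMap.toContinuousLinearMap ((Matrix.traceLinearMap (Fin n) ℝ ℝ).comp
    (matrixRep n).toLinearMap)

lemma traceCLM_apply (T : EuclideanSpace ℝ (Fin n) →L[ℝ] EuclideanSpace ℝ (Fin n)) :
    traceCLM n T = (matrixRep n T).trace := rfl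

end MatrixRep

/-! ### Tangential and normal parts of the Laplacian of the mean curvature vector -/

section MeanCurvature

variable {n s : ℕ} {f ξ : EuclideanSpace ℝ (Fin n) → EuclideanSpace ℝ (Fin (n + 1))}
  {u : EuclideanSpace ℝ (Fin n)} {U : Set (EuclideanSpace ℝ (Fin n))} {ε : ℝ}

local notation "⟪" v "," w "⟫" => scalarProductCLM _ s v w
local notation "e" i => EuclideanSpace.single i (1 : ℝ)
local notation "Γ" => connectionForm f (tangentialProj s f)
local notation "A" => weingarten ξ (tangentialProj s f)

namespace IsAdaptedFrame

lemma sum_metric_inv_mul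
    (h : IsAdaptedFrame (scalarProductCLM (n + 1) s) ε U f ξ (tangentialProj s f)) (hu : u ∈ U)
    (X : EuclideanSpace ℝ (Fin n)) (i : Fin n) :
    ∑ j, (metric s f u)⁻¹ i j * ⟪fderiv ℝ f u (e j), fderiv ℝ f u X⟫ = X i := by
  rw [← tangentialProj_apply, h.proj_fderiv u hu]

lemma sum_metric_inv_mul_bilin
    (h : IsAdaptedFrame (scalarProductCLM (n + 1) s) ε U f ξ (tangentialProj s f)) (hu : u ∈ U)
    (T : EuclideanSpace ℝ (Fin n) →L[ℝ] EuclideanSpace ℝ (Fin n)) :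
    ∑ i, ∑ j, (metric s f u)⁻¹ i j * ⟪fderiv ℝ f u (T (e i)), fderiv ℝ f u (e j)⟫
      = (matrixRep n T).trace := by
  simp only [h.symm _ (fderiv ℝ f u (e _))]
  rw [trace_matrixRep]
  exact Finset.sum_congr rfl fun i _ => h.sum_metric_inv_mul hu _ i

lemma secondFundamentalForm_eq
    (h : IsAdaptedFrame (scalarProductCLM (n + 1) s) ε U f ξ (tangentialProj s f)) (hu : u ∈ U)
    (i j : Fin n) : secondFundamentalForm s f u i j
      = (ε * ⟪fderiv ℝ f u (A u (e i)), fderiv ℝ f u (e j)⟫) • ξ u := by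
  rw [secondFundamentalForm,
    hessian_eq (h.contDiffAt_map u hu) (h.differentiableAt_fderiv hu), h.fderiv_fderiv hu]
  abel

lemma meanCurvatureVector_eq
    (h : IsAdaptedFrame (scalarProductCLM (n + 1) s) ε U f ξ (tangentialProj s f)) (hu : u ∈ U) :
    meanCurvatureVector s f u = (1 / (n : ℝ) * (ε * (matrixRep n (A u)).trace)) • ξ u := by
  rw [meanCurvatureVector, ← h.sum_metric_inv_mul_bilin hu, mul_smul, Finset.mul_sum,
    Finset.sum_smul]
  congr 1
  refine Finset.sum_congr rfl fun i _ => ?_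
  rw [Finset.mul_sum, Finset.sum_smul]
  refine Finset.sum_congr rfl fun j _ => ?_
  rw [h.secondFundamentalForm_eq hu, smul_smul]
  congr 1
  ring

/-- One `ε` comes from the normal component of the second fundamental form, a second from pairing
with `ξ`; they cancel. This transfers the eigenvalue hypothesis to `weingarten`. -/
lemma shapeOperator_eq
    (h : IsAdaptedFrame (scalarProductCLM (n + 1) s) ε U f ξ (tangentialProj s f)) (hu : u ∈ U) :
    shapeOperator s f u (ξ u) = matrixRep n (A u) := by
  ext k j
  rw [matrixRep_apply, ← h.sum_metric_inv_mul hu, shapeOperator, Matrix.mul_apply]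
  refine Finset.sum_congr rfl fun i _ => ?_
  rw [Matrix.of_apply, ← scalarProductCLM_apply, h.secondFundamentalForm_eq hu, map_smul,
    _root_.smul_apply, h.unit u hu, smul_eq_mul, ← h.bilin_weingarten hu]
  congr 1
  linear_combination ⟪fderiv ℝ f u (A u (e i)), fderiv ℝ f u (e j)⟫ * h.sq_eq_one

lemma isUnitNormal
    (h : IsAdaptedFrame (scalarProductCLM (n + 1) s) ε U f ξ (tangentialProj s f)) (hu : u ∈ U) :
    IsUnitNormal s f u (ξ u) := by
  constructor
  · intro i
    rw [← scalarProductCLM_apply, h.symm]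
    exact h.normal u hu _
  · rw [← scalarProductCLM_apply, h.unit u hu]
    exact mul_self_eq_one_iff.mp h.sq_eq_one

variable {r : EuclideanSpace ℝ (Fin n) → ℝ}
  {η : EuclideanSpace ℝ (Fin n) → EuclideanSpace ℝ (Fin (n + 1))}

lemma fderiv_smul_normal
    (h : IsAdaptedFrame (scalarProductCLM (n + 1) s) ε U f ξ (tangentialProj s f))
    (hr : ∀ u ∈ U, ContDiffAt ℝ ∞ r u) (hη : ∀ u ∈ U, η u = r u • ξ u) (hu : u ∈ U)
    (Y : EuclideanSpace ℝ (Fin n)) :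
    fderiv ℝ η u Y = fderiv ℝ r u Y • ξ u - r u • fderiv ℝ f u (A u Y) := by
  rw [fderiv_congr_of_isOpen h.isOpen hη hu,
    fderiv_fun_smul ((hr u hu).differentiableAt (by simp)) (h.differentiableAt_normal hu)]
  simp only [_root_.add_apply, _root_.smul_apply, ContinuousLinearMap.smulRight_apply,
    h.fderiv_normal hu]
  module

lemma contDiffAt_smul_normal
    (h : IsAdaptedFrame (scalarProductCLM (n + 1) s) ε U f ξ (tangentialProj s f))
    (hr : ∀ u ∈ U, ContDiffAt ℝ ∞ r u) (hη : ∀ u ∈ U, η u = r u • ξ u) (hu : u ∈ U) :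
    ContDiffAt ℝ ∞ η u :=
  ((hr u hu).smul (h.contDiffAt_normal u hu)).congr_of_eventuallyEq
    (Filter.eventually_of_mem (h.isOpen.mem_nhds hu) hη)

lemma hessian_smul_normal
    (h : IsAdaptedFrame (scalarProductCLM (n + 1) s) ε U f ξ (tangentialProj s f))
    (hr : ∀ u ∈ U, ContDiffAt ℝ ∞ r u) (hη : ∀ u ∈ U, η u = r u • ξ u) (hu : u ∈ U)
    (i j : Fin n) :
    hessian s f η u i j = -fderiv ℝ f u (fderiv ℝ r u (e j) • A u (e i)
        + fderiv ℝ r u (e i) • A u (e j) + r u • covD Γ A u (e i) (e j))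
      + (fderiv ℝ (fderiv ℝ r) u (e i) (e j) - fderiv ℝ r u (Γ u (e i) (e j))
        - r u * (ε * ⟪fderiv ℝ f u (A u (e i)), fderiv ℝ f u (A u (e j))⟫)) • ξ u := by
  have hη1 : DifferentiableAt ℝ (fderiv ℝ η) u :=
    (ContDiffAt.fderiv_infty (h.contDiffAt_smul_normal hr hη hu)).differentiableAt (by simp)
  have hr0 := (hr u hu).differentiableAt (by simp)
  have hr1 : DifferentiableAt ℝ (fderiv ℝ r) u :=
    (ContDiffAt.fderiv_infty (hr u hu)).differentiableAt (by simp)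
  have hr1' : DifferentiableAt ℝ (fun y => fderiv ℝ r y (e j)) u :=
    hr1.clm_apply (differentiableAt_const _)
  have hA : DifferentiableAt ℝ (fun y => A y (e j)) u :=
    (h.differentiableAt_weingarten hu).clm_apply (differentiableAt_const _)
  have hFA : DifferentiableAt ℝ (fun y => fderiv ℝ f y (A y (e j))) u :=
    (h.differentiableAt_fderiv hu).clm_apply hA
  rw [hessian_eq (h.contDiffAt_map u hu) hη1, ← fderiv_clm_apply_const hη1,
    fderiv_congr_of_isOpen h.isOpen (fun y hy => h.fderiv_smul_normal hr hη hy (e j)) hu,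
    fderiv_fun_sub (hr1'.fun_smul (h.differentiableAt_normal hu)) (hr0.fun_smul hFA),
    fderiv_fun_smul hr1' (h.differentiableAt_normal hu), fderiv_fun_smul hr0 hFA,
    h.fderiv_smul_normal hr hη hu]
  simp only [_root_.add_apply, _root_.sub_apply, _root_.smul_apply,
    ContinuousLinearMap.smulRight_apply, h.fderiv_normal hu, h.fderiv_fderiv_apply hu hA,
    fderiv_clm_apply_const hr1, fderiv_clm_apply_const (h.differentiableAt_weingarten hu),
    covD, ContinuousLinearMap.mul_def, ContinuousLinearMap.comp_apply, map_add, map_sub,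
    map_smul]
  module

/-- The tangential part of `Δ H⃗ = c H⃗`: the gradient of the mean curvature is a principal
direction, with principal curvature `- n ε H / 2`. -/
lemma exists_gradient_eigenvector
    (h : IsAdaptedFrame (scalarProductCLM (n + 1) s) ε U f ξ (tangentialProj s f))
    (hr : ∀ u ∈ U, ContDiffAt ℝ ∞ r u) (hη : ∀ u ∈ U, η u = r u • ξ u)
    (htr : ∀ u ∈ U, (matrixRep n (A u)).trace = n * ε * r u) (hu : u ∈ U) {c : ℝ}
    (hL : laplacian s f η u = c • η u) :
    ∃ N, (∀ Z, ⟪fderiv ℝ f u N, fderiv ℝ f u Z⟫ = fderiv ℝ r u Z) ∧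
      A u N = (-(n * ε * r u / 2)) • N := by
  -- `N` is the gradient of `r`, and `M` the metric trace (divergence) of `∇A`.
  set N : EuclideanSpace ℝ (Fin n) :=
    ∑ i, ∑ j, ((metric s f u)⁻¹ i j * fderiv ℝ r u (e j)) • e i with hN
  set M : EuclideanSpace ℝ (Fin n) :=
    ∑ i, ∑ j, (metric s f u)⁻¹ i j • covD Γ A u (e i) (e j) with hM
  have hNZ : ∀ Z, ⟪fderiv ℝ f u N, fderiv ℝ f u Z⟫ = fderiv ℝ r u Z := fun Z => by
    conv_rhs => rw [← sum_smul_single Z]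
    rw [hN, Finset.sum_comm]
    simp only [map_sum, map_smul, _root_.sum_apply, _root_.smul_apply, smul_eq_mul]
    refine Finset.sum_congr rfl fun j _ => ?_
    rw [← h.sum_metric_inv_mul hu, Finset.sum_mul]
    refine Finset.sum_congr rfl fun i _ => ?_
    rw [metric_inv_comm j i]; ring
  -- The connection enters `∇A` through a commutator, which has no trace.
  have htrC : ∀ Z, (matrixRep n (covD Γ A u Z)).trace = n * ε * fderiv ℝ r u Z := fun Z => by
    have h1 : fderiv ℝ (fun y => traceCLM n (A y)) u Z = traceCLM n (fderiv ℝ A u Z) := by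
      have := fderiv_comp u (traceCLM n).differentiableAt (h.differentiableAt_weingarten hu)
      rw [show (fun y => traceCLM n (A y)) = traceCLM n ∘ A from rfl, this,
        ContinuousLinearMap.fderiv]
      rfl
    have h2 : fderiv ℝ (fun y => traceCLM n (A y)) u Z = n * ε * fderiv ℝ r u Z := by
      rw [fderiv_congr_of_isOpen h.isOpen (show ∀ y ∈ U, traceCLM n (A y) = n * ε * r y from htr) hu,
        fderiv_const_mul ((hr u hu).differentiableAt (by simp))]
      simp
    rw [covD, map_sub, map_add, Matrix.trace_sub, Matrix.trace_add, map_mul, map_mul,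
      Matrix.trace_mul_comm (matrixRep n (A u)), add_sub_cancel_right, ← traceCLM_apply, ← h1, h2]
  -- By self-adjointness and Codazzi, the divergence of `A` is the gradient of its trace.
  have hMZ : ∀ Z, ⟪fderiv ℝ f u M, fderiv ℝ f u Z⟫ = n * ε * fderiv ℝ r u Z := fun Z => by
    rw [← htrC, ← h.sum_metric_inv_mul_bilin hu, hM]
    simp only [map_sum, map_smul, _root_.sum_apply, _root_.smul_apply, smul_eq_mul]
    refine Finset.sum_congr rfl fun i _ => Finset.sum_congr rfl fun j _ => ?_
    rw [h.bilin_covD_weingarten hu, h.codazzi hu, h.symm]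
  have hMN : M = (n * ε) • N := by
    rw [← sub_eq_zero]
    refine h.nondegenerate u hu _ fun Z => ?_
    rw [map_sub, map_smul, map_sub, map_smul, _root_.sub_apply, _root_.smul_apply, hMZ, hNZ,
      smul_eq_mul, sub_self]
  have hAN : A u N = ∑ i, ∑ j, (metric s f u)⁻¹ i j • (fderiv ℝ r u (e j) • A u (e i)) := by
    simp only [hN, map_sum, map_smul, smul_smul]
  have hAN' : A u N = ∑ i, ∑ j, (metric s f u)⁻¹ i j • (fderiv ℝ r u (e i) • A u (e j)) := by
    rw [hAN, Finset.sum_comm]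
    simp only [metric_inv_comm]
  -- The right-hand side is normal, so the tangential part reads `2 A N + r M = 0`.
  have h3 := congrArg (tangentialProj s f u) hL
  rw [laplacian, hη u hu, map_smul, map_smul, h.proj_normal hu, smul_zero, smul_zero, map_neg,
    neg_eq_zero] at h3
  simp only [h.hessian_smul_normal hr hη hu, map_sum, map_smul, map_add (tangentialProj s f u),
    map_neg, h.proj_fderiv u hu, h.proj_normal hu, smul_zero, smul_neg, smul_add,
    Finset.sum_neg_distrib, Finset.sum_add_distrib, Finset.sum_const_zero, add_zero,
    neg_eq_zero] at h3
  rw [← hAN, ← hAN'] at h3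
  have h4 : ∑ i, ∑ j, (metric s f u)⁻¹ i j • r u • covD Γ A u (e i) (e j) = r u • M := by
    simp only [hM, Finset.smul_sum]
    exact Finset.sum_congr rfl fun i _ => Finset.sum_congr rfl fun j _ => smul_comm _ _ _
  rw [h4, hMN] at h3
  refine ⟨N, hNZ, ?_⟩
  rw [← sub_eq_zero]
  have h5 : A u N - (-(n * ε * r u / 2)) • N
      = (1 / 2 : ℝ) • (A u N + A u N + r u • (n * ε) • N) := by module
  rw [h5, h3, smul_zero]

/-- The normal part of `Δ H⃗ = c H⃗` when the mean curvature is constant. -/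
lemma trace_sq_of_laplacian
    (h : IsAdaptedFrame (scalarProductCLM (n + 1) s) ε U f ξ (tangentialProj s f))
    (hr : ∀ u ∈ U, ContDiffAt ℝ ∞ r u) (hη : ∀ u ∈ U, η u = r u • ξ u)
    (hr0 : ∀ u ∈ U, fderiv ℝ r u = 0) (hu : u ∈ U) (hru : r u ≠ 0) {c : ℝ}
    (hL : laplacian s f η u = c • η u) :
    (matrixRep n (A u) * matrixRep n (A u)).trace = ε * c := by
  have hrr : fderiv ℝ (fderiv ℝ r) u = 0 := by
    rw [fderiv_congr_of_isOpen h.isOpen hr0 hu]; simp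
  -- With `r` constant, only the term `r ε ⟨A∂ᵢ, A∂ⱼ⟩` of the Hessian survives in the normal
  -- direction.
  have h1 := congrArg (fun w => ⟪w, ξ u⟫) hL
  simp only [laplacian, h.hessian_smul_normal hr hη hu, hr0 u hu, hrr, hη u hu, map_sum, map_smul,
    map_add, map_neg, _root_.sum_apply, _root_.smul_apply, _root_.add_apply, _root_.neg_apply,
    h.normal u hu, h.unit u hu, smul_eq_mul, _root_.zero_apply, sub_zero, zero_sub,
    zero_add, zero_smul] at h1
  have h2 : (matrixRep n (A u) * matrixRep n (A u)).trace
      = ∑ i, ∑ j, (metric s f u)⁻¹ i j * ⟪fderiv ℝ f u (A u (e i)), fderiv ℝ f u (A u (e j))⟫ := by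
    rw [← map_mul, ← h.sum_metric_inv_mul_bilin hu]
    simp only [ContinuousLinearMap.mul_def, ContinuousLinearMap.comp_apply, h.bilin_weingarten hu]
  have h3 : r u * (matrixRep n (A u) * matrixRep n (A u)).trace = r u * (ε * c) := by
    rw [h2, Finset.mul_sum]
    simp only [Finset.mul_sum]
    rw [show r u * (ε * c) = c * (r u * ε) by ring, ← h1, ← Finset.sum_neg_distrib]
    refine Finset.sum_congr rfl fun i _ => ?_
    rw [← Finset.sum_neg_distrib]
    refine Finset.sum_congr rfl fun j _ => ?_
    linear_combination (-(r u * ((metric s f u)⁻¹ i j *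
      ⟪fderiv ℝ f u (A u (e i)), fderiv ℝ f u (A u (e j))⟫))) * h.sq_eq_one
  exact mul_left_cancel₀ hru h3

end IsAdaptedFrame

end MeanCurvature

end

/-! ### Contradiction near a point of nonzero mean curvature, and the global statement -/

noncomputable section

/-- A four-dimensional hypersurface with `Δ H⃗ = c H⃗`, `H⃗ ≠ 0`, cannot have two imaginary principal
curvatures of multiplicity two. -/
theorem IsAdaptedFrame.false_of_laplacian {s : ℕ}
    {f ξ η : EuclideanSpace ℝ (Fin 4) → EuclideanSpace ℝ (Fin (4 + 1))}
    {r : EuclideanSpace ℝ (Fin 4) → ℝ} {D : Set (EuclideanSpace ℝ (Fin 4))} {ε c : ℝ}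
    (h : IsAdaptedFrame (scalarProductCLM (4 + 1) s) ε D f ξ (tangentialProj s f))
    (hD : IsPreconnected D) (hne : D.Nonempty)
    (hrs : ∀ u ∈ D, ContDiffAt ℝ ∞ r u) (hr0 : ∀ u ∈ D, r u ≠ 0) (hη : ∀ u ∈ D, η u = r u • ξ u)
    (htr : ∀ u ∈ D, (matrixRep 4 (weingarten ξ (tangentialProj s f) u)).trace
      = (4 : ℕ) * ε * r u)
    (heig : ∀ u ∈ D, ∃ a b : ℝ, b ≠ 0 ∧
      ((weingarten ξ (tangentialProj s f) u - a • 1) * (weingarten ξ (tangentialProj s f) u - a • 1)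
        + b ^ 2 • 1) * ((weingarten ξ (tangentialProj s f) u - a • 1)
          * (weingarten ξ (tangentialProj s f) u - a • 1) + b ^ 2 • 1) = 0 ∧
      (matrixRep 4 (weingarten ξ (tangentialProj s f) u)).trace = 4 * a ∧
      (matrixRep 4 (weingarten ξ (tangentialProj s f) u)
        * matrixRep 4 (weingarten ξ (tangentialProj s f) u)).trace = 4 * (a ^ 2 - b ^ 2))
    (hL : ∀ u ∈ D, laplacian s f η u = c • η u) : False := by
  obtain ⟨u₀, huD⟩ := hne
  have hdr : ∀ u ∈ D, fderiv ℝ r u = 0 := fun u hu => by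
    obtain ⟨a, b, hb, hQ, -, -⟩ := heig u hu
    obtain ⟨N, hN, hAN⟩ := h.exists_gradient_eigenvector hrs hη htr hu (hL u hu)
    have hN0 : N = 0 := eq_zero_of_apply_eq_smul (sub_add_cancel _ (a • 1)).symm hb rfl
      (fun v => by simpa using DFunLike.congr_fun hQ v) hAN
    ext Z
    rw [← hN Z, hN0]
    simp
  have hconst : ∀ u ∈ D, r u = r u₀ := fun u hu =>
    h.isOpen.is_const_of_fderiv_eq_zero hD
      (fun v hv => ((hrs v hv).differentiableAt (by simp)).differentiableWithinAt) hdr hu huD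
  have htr2 : ∀ u ∈ D, (matrixRep 4 (weingarten ξ (tangentialProj s f) u)
      * matrixRep 4 (weingarten ξ (tangentialProj s f) u)).trace = ε * c := fun u hu =>
    h.trace_sq_of_laplacian hrs hη hdr hu (hr0 u hu) (hL u hu)
  obtain ⟨a, b, hb, -, ha4, hb4⟩ := heig u₀ huD
  refine h.false_of_constant_imaginary (by simp) ⟨u₀, huD⟩ hb (a := a) fun u hu => ?_
  obtain ⟨a', b', -, hQ, ha4', hb4'⟩ := heig u hu
  have haa : a' = a := by
    rw [htr u₀ huD] at ha4
    rw [htr u hu, hconst u hu] at ha4'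
    linarith
  subst haa
  have hbb : b' ^ 2 = b ^ 2 := by
    rw [htr2 u₀ huD] at hb4
    rw [htr2 u hu] at hb4'
    linarith
  rwa [hbb] at hQ

/-- The local form of the theorem, on a coordinate patch. -/
theorem meanCurvatureVector_eq_zero {s : ℕ}
    {f : EuclideanSpace ℝ (Fin 4) → EuclideanSpace ℝ (Fin (4 + 1))}
    {U : Set (EuclideanSpace ℝ (Fin 4))} (hU : IsOpen U)
    (hf : ∀ u ∈ U, ContDiffAt ℝ ∞ f u) (hdet : ∀ u ∈ U, (metric s f u).det ≠ 0) {c : ℝ}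
    (hL : ∀ u ∈ U, laplacian s f (meanCurvatureVector s f) u = c • meanCurvatureVector s f u)
    (himag : ∀ u ∈ U, ∀ ξ, IsUnitNormal s f u ξ → (principalCurvatures s f u ξ).ncard = 2 ∧
      ∀ κ ∈ principalCurvatures s f u ξ, κ.im ≠ 0) {u₀ : EuclideanSpace ℝ (Fin 4)}
    (hu₀ : u₀ ∈ U) : meanCurvatureVector s f u₀ = 0 := by
  by_contra hH
  set H := meanCurvatureVector s f with hHdef
  have hHn : ∀ u ∈ U, ∀ X, scalarProductCLM (4 + 1) s (fderiv ℝ f u X) (H u) = 0 := fun u hu X =>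
    scalarProductCLM_meanCurvatureVector (hf u hu) (hdet u hu) X
  have hHs : ∀ u ∈ U, ContDiffAt ℝ ∞ H u := fun u hu =>
    contDiffAt_meanCurvatureVector hU hf hdet hu
  set ρ : EuclideanSpace ℝ (Fin 4) → ℝ := fun u => scalarProductCLM (4 + 1) s (H u) (H u) with hρ
  have hρs : ∀ u ∈ U, ContDiffAt ℝ ∞ ρ u := fun u hu =>
    (contDiffAt_const.clm_apply (hHs u hu)).clm_apply (hHs u hu)
  have hρ0 : ρ u₀ ≠ 0 := scalarProductCLM_self_ne_zero (n := 4) (hdet u₀ hu₀) hH (hHn u₀ hu₀)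
  -- `ε` is the causal sign of the mean curvature vector at `u₀`. It persists on a ball, which is
  -- also connected, as needed to pass from zero gradient to a constant.
  obtain ⟨ε, hε, hpos⟩ : ∃ ε : ℝ, ε * ε = 1 ∧ 0 < ε * ρ u₀ := by
    rcases lt_or_gt_of_ne hρ0 with hlt | hgt
    · exact ⟨-1, by norm_num, by linarith⟩
    · exact ⟨1, by norm_num, by linarith⟩
  have hnhds : ∀ᶠ u in nhds u₀, u ∈ U ∧ 0 < ε * ρ u :=
    (hU.eventually_mem hu₀).and
      ((((hρs u₀ hu₀).continuousAt.const_mul ε)).eventually_const_lt hpos)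
  obtain ⟨δ, hδ, hball⟩ := Metric.eventually_nhds_iff_ball.mp hnhds
  set D := Metric.ball u₀ δ with hD
  have hDo : IsOpen D := Metric.isOpen_ball
  have hD_conn : IsPreconnected D := (convex_ball u₀ δ).isPreconnected
  have huD : u₀ ∈ D := Metric.mem_ball_self hδ
  set r : EuclideanSpace ℝ (Fin 4) → ℝ := fun u => √(ε * ρ u) with hr
  have hr0 : ∀ u ∈ D, r u ≠ 0 := fun u hu => (Real.sqrt_pos.mpr (hball u hu).2).ne'
  have hrr : ∀ u ∈ D, r u * r u = ε * ρ u := fun u hu =>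
    Real.mul_self_sqrt (hball u hu).2.le
  have hrs : ∀ u ∈ D, ContDiffAt ℝ ∞ r u := fun u hu =>
    (contDiffAt_const.mul (hρs u (hball u hu).1)).sqrt (hball u hu).2.ne'
  set ξ : EuclideanSpace ℝ (Fin 4) → EuclideanSpace ℝ (Fin (4 + 1)) := fun u => (r u)⁻¹ • H u with hξ
  have hHξ : ∀ u ∈ D, H u = r u • ξ u := fun u hu => by
    rw [hξ, smul_smul, mul_inv_cancel₀ (hr0 u hu), one_smul]
  have h : IsAdaptedFrame (scalarProductCLM (4 + 1) s) ε D f ξ (tangentialProj s f) := by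
    refine isAdaptedFrame_tangentialProj hDo (fun u hu => hf u (hball u hu).1)
      (fun u hu => hdet u (hball u hu).1) hε
      (fun u hu => ((hrs u hu).inv (hr0 u hu)).smul (hHs u (hball u hu).1)) (fun u hu => ?_)
      (fun u hu X => ?_)
    · have h1 : scalarProductCLM (4 + 1) s (ξ u) (ξ u) = (r u)⁻¹ * ((r u)⁻¹ * ρ u) := by
        simp [hξ, hρ]
      have h2 : ρ u = ε * (r u * r u) := by
        rw [hrr u hu]; linear_combination (-ρ u) * hε
      rw [h1, h2]
      field_simp [hr0 u hu]
    · rw [hξ, map_smul, hHn u (hball u hu).1, smul_zero]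
  have htr : ∀ u ∈ D, (matrixRep 4 (weingarten ξ (tangentialProj s f) u)).trace
      = (4 : ℕ) * ε * r u := fun u hu => by
    have h1 := h.meanCurvatureVector_eq hu
    rw [← hHdef, hHξ u hu] at h1
    -- Pairing with `ξ` compares the two expressions of the mean curvature vector as multiples of
    -- `ξ`.
    have h2 := congrArg (fun w => scalarProductCLM (4 + 1) s w (ξ u)) h1
    simp only [map_smul, _root_.smul_apply, h.unit u hu, smul_eq_mul] at h2
    have hε0 : ε ≠ 0 := fun h0 => by simp [h0] at hε
    have h3 := mul_right_cancel₀ hε0 h2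
    rw [h3]
    push_cast
    linear_combination (-(matrixRep 4 (weingarten ξ (tangentialProj s f) u)).trace) * hε
  have heig : ∀ u ∈ D, ∃ a b : ℝ, b ≠ 0 ∧
      ((weingarten ξ (tangentialProj s f) u - a • 1) * (weingarten ξ (tangentialProj s f) u - a • 1)
        + b ^ 2 • 1) * ((weingarten ξ (tangentialProj s f) u - a • 1)
          * (weingarten ξ (tangentialProj s f) u - a • 1) + b ^ 2 • 1) = 0 ∧
      (matrixRep 4 (weingarten ξ (tangentialProj s f) u)).trace = 4 * a ∧
      (matrixRep 4 (weingarten ξ (tangentialProj s f) u)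
        * matrixRep 4 (weingarten ξ (tangentialProj s f) u)).trace = 4 * (a ^ 2 - b ^ 2) :=
    fun u hu => by
      obtain ⟨h1, h2⟩ := himag u (hball u hu).1 (ξ u) (h.isUnitNormal hu)
      rw [principalCurvatures, h.shapeOperator_eq hu] at h1 h2
      obtain ⟨a, b, hb, h3, h4, h5⟩ := exists_of_two_imaginary_eigenvalues _ h1 h2
      refine ⟨a, b, hb, matrixRep_injective ?_, h4, h5⟩
      simpa only [map_mul, map_add, map_sub, map_smul, map_one, map_zero] using h3
  exact h.false_of_laplacian hD_conn ⟨u₀, huD⟩ hrs hr0 hHξ htr heig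
    fun u hu => hL u (hball u hu).1

end

end PseudoEuclidean

theorem corollary4p9 (s : ℕ) (hs : s ≤ 5)
    {M : Type*} [TopologicalSpace M] [ChartedSpace (EuclideanSpace ℝ (Fin 4)) M]
    [IsManifold (𝓡 4) ∞ M]
    (x : M → EuclideanSpace ℝ (Fin 5))
    (hx : PseudoEuclidean.IsNondegenerateHypersurface s x)
    (hproper : PseudoEuclidean.HasProperMeanCurvatureVector s x)
    (himag : PseudoEuclidean.HasTwoImaginaryPrincipalCurvatures s x) :
    PseudoEuclidean.IsMinimal s x := by
  intro e he u hu
  obtain ⟨c, hc⟩ := hproper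
  have hsmooth : ContDiffOn ℝ ∞ (x ∘ e.symm) e.target :=
    contMDiffOn_iff_contDiffOn.mp
      (hx.smooth.comp_contMDiffOn (contMDiffOn_symm_of_mem_maximalAtlas he))
  exact PseudoEuclidean.meanCurvatureVector_eq_zero e.open_target
    (fun v hv => hsmooth.contDiffAt (e.open_target.mem_nhds hv)) (hx.nondegenerate e he)
    (hc e he) (himag e he) hu
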